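/- Let $K\ge 2$ be an integer. Write $\langle f,g\rangle=\int_0^1 f(x)\overline{g(x)}\,dx$, and for $j\ge 1$ let $\lambda_j=(j\pi)^2$ and $\varphi_j(x)=\sqrt2\,\sin(j\pi x)$. Then there exists a function $\mu\in H^{11}((0,1),\mathbb R)$ such that all of the following hold: (H$_{\mathrm{reg}}$) $\mu'(0)=\mu'(1)=\mu^{(3)}(0)=\mu^{(3)}(1)=0$; (H$_{\mathrm{lin}}$) $\langle\mu\varphi_1,\varphi_K\rangle=0$, and there is a constant $c>0$ such that $|\langle\mu\varphi_1,\varphi_j\rangle|\ge c\,j^{-7}$ for every integer $j\ge1$ with $j\ne K$; (H$_{\mathrm{Quad}}$) $A^1_K=0$, $A^2_K=0$ and $A^3_K\ne0$, where, for $p=1,2,3$, $$A^p_K=(-1)^{p-1}\sum_{j=1}^{\infty}\Big(\lambda_j-\frac{\lambda_1+\lambda_K}{2}\Big)(\lambda_K-\lambda_j)^{p-1}(\lambda_j-\lambda_1)^{p-1}\langle\mu\varphi_1,\varphi_j\rangle\langle\mu\varphi_K,\varphi_j\rangle ;$$ (H$_{\mathrm{Cub}}$) $C_K\ne0$, where $$C_K=\sum_{j=1}^{\infty}(\lambda_1-\lambda_j)\langle\mu\varphi_1,\varphi_j\rangle\langle(\mu')^2\varphi_K,\varphi_j\rangle-\sum_{j=1}^{\infty}(\lambda_j-\lambda_K)\langle\mu\varphi_j,\varphi_K\rangle\langle(\mu')^2\varphi_1,\varphi_j\rangle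 .$$ All the series above converge absolutely. -/

import Mathlib

open MeasureTheory Set
open scoped ContDiff

noncomputable section

namespace DipoleMoment

/-- Lebesgue measure on the interval `(0,1)`. -/
def vol01 : Measure ℝ := (volume : Measure ℝ).restrict (Ioo 0 1)

/-- Smooth real functions with compact support in `(0,1)`. -/
def IsTestFunction (θ : ℝ → ℝ) : Prop :=
  ContDiff ℝ ∞ θ ∧ HasCompactSupport θ ∧ tsupport θ ⊆ Ioo 0 1

/-- `g` is a weak derivative of order `k` of `f` on `(0,1)`; only the values of `f` and `g` on
`(0,1)`, up to a null set, matter. -/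
def IsWeakDeriv (k : ℕ) (f g : ℝ → ℝ) : Prop :=
  LocallyIntegrableOn f (Ioo 0 1) ∧ LocallyIntegrableOn g (Ioo 0 1) ∧
    ∀ θ : ℝ → ℝ, IsTestFunction θ →
      ∫ x, f x * iteratedDeriv k θ x ∂vol01 = (-1) ^ k * ∫ x, g x * θ x ∂vol01

/-- The Sobolev space `H^m((0,1), ℝ)`: all weak derivatives of order at most `m` exist and are
square integrable. -/
def MemSobolev (m : ℕ) (f : ℝ → ℝ) : Prop :=
  MemLp f 2 vol01 ∧ ∀ k ≤ m, ∃ g : ℝ → ℝ, IsWeakDeriv k f g ∧ MemLp g 2 vol01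

open Classical in
/-- A representative of the weak derivative of order `k` of `f` on `(0,1)`; it is unique up to a
null set of `(0,1)`. (The value is `0` if there is no weak derivative.) -/
def weakDeriv (k : ℕ) (f : ℝ → ℝ) : ℝ → ℝ :=
  if h : ∃ g : ℝ → ℝ, IsWeakDeriv k f g then h.choose else 0

/-- The class of `f` modulo null sets of `(0,1)` has a representative which is continuous on
`[0,1]`, and this representative has the value `v` at the point `a ∈ [0,1]`. -/
def HasTrace (f : ℝ → ℝ) (a v : ℝ) : Prop :=
  ∃ g : ℝ → ℝ, ContinuousOn g (Icc 0 1) ∧ g =ᵐ[vol01] f ∧ g a = v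

/-- The scalar product of `L²(0,1)`, on real functions. -/
def ip (f g : ℝ → ℝ) : ℝ := ∫ x, f x * g x ∂vol01

/-- The eigenvalues `λ_j = (jπ)²` of the Dirichlet Laplacian on `(0,1)`. -/
def lam (j : ℕ) : ℝ := (j * Real.pi) ^ 2

/-- The eigenfunctions `φ_j = √2 sin(jπ·)` of the Dirichlet Laplacian on `(0,1)`. -/
def phi (j : ℕ) (x : ℝ) : ℝ := √2 * Real.sin (j * Real.pi * x)

/-- Regularity: `μ ∈ H¹¹((0,1), ℝ)` and `μ'(0) = μ'(1) = μ⁽³⁾(0) = μ⁽³⁾(1) = 0`. -/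
def HReg (μ : ℝ → ℝ) : Prop :=
  MemSobolev 11 μ ∧
    HasTrace (weakDeriv 1 μ) 0 0 ∧ HasTrace (weakDeriv 1 μ) 1 0 ∧
    HasTrace (weakDeriv 3 μ) 0 0 ∧ HasTrace (weakDeriv 3 μ) 1 0

/-- The linear assumption: the `K`-th coefficient `⟨μφ₁, φ_K⟩` vanishes, and the other ones are
bounded from below by a multiple of `j⁻⁷`. -/
def HLin (K : ℕ) (μ : ℝ → ℝ) : Prop :=
  ip (μ * phi 1) (phi K) = 0 ∧
    ∃ c : ℝ, 0 < c ∧ ∀ j : ℕ, 1 ≤ j → j ≠ K → c / (j : ℝ) ^ 7 ≤ |ip (μ * phi 1) (phi j)|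

/-- The `j`-th term of the series defining `A^p_K`, without the sign `(-1)^(p-1)`; `p ≥ 1`. -/
def quadTerm (p K : ℕ) (μ : ℝ → ℝ) (j : ℕ) : ℝ :=
  (lam j - (lam 1 + lam K) / 2) * (lam K - lam j) ^ (p - 1) * (lam j - lam 1) ^ (p - 1) *
    ip (μ * phi 1) (phi j) * ip (μ * phi K) (phi j)

/-- The quadratic coefficient `A^p_K`, for `p ≥ 1`. -/
def quadCoeff (p K : ℕ) (μ : ℝ → ℝ) : ℝ :=
  (-1) ^ (p - 1) * ∑' j : ℕ+, quadTerm p K μ j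

/-- The quadratic assumption `A¹_K = A²_K = 0`, `A³_K ≠ 0`, the three series being absolutely
convergent. -/
def HQuad (K : ℕ) (μ : ℝ → ℝ) : Prop :=
  (Summable fun j : ℕ+ => quadTerm 1 K μ j) ∧
    (Summable fun j : ℕ+ => quadTerm 2 K μ j) ∧
    (Summable fun j : ℕ+ => quadTerm 3 K μ j) ∧
    quadCoeff 1 K μ = 0 ∧ quadCoeff 2 K μ = 0 ∧ quadCoeff 3 K μ ≠ 0

/-- The `j`-th term of the first series in `C_K`. -/
def cubTerm₁ (K : ℕ) (μ : ℝ → ℝ) (j : ℕ) : ℝ :=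
  (lam 1 - lam j) * ip (μ * phi 1) (phi j) * ip (weakDeriv 1 μ ^ 2 * phi K) (phi j)

/-- The `j`-th term of the second series in `C_K`. -/
def cubTerm₂ (K : ℕ) (μ : ℝ → ℝ) (j : ℕ) : ℝ :=
  (lam j - lam K) * ip (μ * phi j) (phi K) * ip (weakDeriv 1 μ ^ 2 * phi 1) (phi j)

/-- The cubic coefficient `C_K`. -/
def cubCoeff (K : ℕ) (μ : ℝ → ℝ) : ℝ :=
  (∑' j : ℕ+, cubTerm₁ K μ j) - (∑' j : ℕ+, cubTerm₂ K μ j)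

/-- The cubic assumption `C_K ≠ 0`, the two series being absolutely convergent. -/
def HCub (K : ℕ) (μ : ℝ → ℝ) : Prop :=
  (Summable fun j : ℕ+ => cubTerm₁ K μ j) ∧ (Summable fun j : ℕ+ => cubTerm₂ K μ j) ∧
    cubCoeff K μ ≠ 0

end DipoleMoment

end

/-!
The function `μ` is sought in the form `ε f + ∑ yᵢ · 2 cos(nᵢπx)` with five high frequencies `nᵢ`.
All matrix elements `⟨μφᵢ, φⱼ⟩` are differences of the cosine coefficients of `μ`
(`ip_mul_phi_phi`), and those of a single cosine are supported on two indices, so that everything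
is an explicit finite computation as long as `ε = 0`.

* The background `f` is an even polynomial of degree six, modified at two frequencies. Its cosine
  coefficients are `(-1)ⁿ n⁻⁶`, whence `⟨fφ₁, φⱼ⟩` is of exact order `j⁻⁷`; it vanishes for `j = K`
  (`exists_linear_background`). It provides the lower bound in `HLin`.
* The form `A^p_K` couples two high frequencies only if they differ by `K - 1` or `K + 1`. For
  `ε = 0` it is therefore a sum of three terms, one for each interacting pair, and for
  `p = 1, 2, 3` the coefficients of these terms are the first three moments of positive measures
  with ordered disjoint supports (`quadCoeff_candidate`). Their determinant is a sum of Vandermonde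
  determinants, hence positive (`moment_det_pos`), and so are the minors (`moment_minor_pos`). Thus
  `A¹ = A² = 0` has a solution with all amplitudes different from zero, and `A³ ≠ 0` there.
* The cubic coefficient is nonzero for the sum of the cosines with the frequencies `L` and
  `2L + K + 1` (`cubCoeff_cosine_add`), and is continuous in the amplitudes. The other three
  amplitudes can be taken proportional to a small `δ`, so it stays nonzero.

For small `ε > 0` the two equations `A¹ = A² = 0` are still solved by Cramer's rule, with amplitudes
depending continuously on `ε`, and the conditions `A³ ≠ 0`, `C ≠ 0` and `⟨μφ₁, φⱼ⟩ ≠ 0` at the ten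
indices `j` next to the frequencies persist; at all other indices `⟨μφ₁, φⱼ⟩ = ε ⟨fφ₁, φⱼ⟩`.
-/

namespace DipoleMoment

/-! ### Weak derivatives of smooth functions -/

lemma integral_vol01 (f : ℝ → ℝ) : ∫ x, f x ∂vol01 = ∫ x in (0 : ℝ)..1, f x := by
  rw [intervalIntegral.integral_of_le zero_le_one, integral_Ioc_eq_integral_Ioo, vol01]

lemma integrable_vol01 {f : ℝ → ℝ} (hf : Continuous f) : Integrable f vol01 := by
  have h : IntegrableOn f (Icc 0 1) := hf.continuousOn.integrableOn_compact isCompact_Icc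
  exact h.mono_set Ioo_subset_Icc_self

lemma memLp_vol01 {f : ℝ → ℝ} (hf : Continuous f) : MemLp f 2 vol01 :=
  (memLp_two_iff_integrable_sq hf.aestronglyMeasurable).2 (integrable_vol01 (hf.pow 2))

lemma IsTestFunction.deriv {θ : ℝ → ℝ} (hθ : IsTestFunction θ) : IsTestFunction (deriv θ) :=
  ⟨(contDiff_infty_iff_deriv.1 hθ.1).2, hθ.2.1.deriv, tsupport_deriv_subset.trans hθ.2.2⟩

lemma IsTestFunction.apply_eq_zero {θ : ℝ → ℝ} (hθ : IsTestFunction θ) {x : ℝ}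
    (hx : x ∉ Ioo (0 : ℝ) 1) : θ x = 0 :=
  image_eq_zero_of_notMem_tsupport fun h => hx (hθ.2.2 h)

lemma integral_mul_iteratedDeriv_test (k : ℕ) {f θ : ℝ → ℝ} (hf : ContDiff ℝ ∞ f)
    (hθ : IsTestFunction θ) :
    ∫ x, f x * iteratedDeriv k θ x ∂vol01
      = (-1) ^ k * ∫ x, iteratedDeriv k f x * θ x ∂vol01 := by
  induction k generalizing θ with
  | zero => simp
  | succ k ih =>
    have hf' : ContDiff ℝ ∞ (iteratedDeriv k f) := by
      rw [iteratedDeriv_eq_iterate]; exact hf.iterate_deriv k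
    have hd : ∀ {g : ℝ → ℝ}, ContDiff ℝ ∞ g →
        ∀ x ∈ uIcc (0 : ℝ) 1, HasDerivAt g (deriv g x) x :=
      fun hg x _ => ((contDiff_infty_iff_deriv.1 hg).1 x).hasDerivAt
    have hc : ∀ {g : ℝ → ℝ}, ContDiff ℝ ∞ g → IntervalIntegrable (deriv g) volume 0 1 :=
      fun hg => (contDiff_infty_iff_deriv.1 hg).2.continuous.intervalIntegrable _ _
    rw [iteratedDeriv_succ', ih hθ.deriv, iteratedDeriv_succ, integral_vol01, integral_vol01,
      intervalIntegral.integral_mul_deriv_eq_deriv_mul (hd hf') (hd hθ.1) (hc hf') (hc hθ.1),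
      hθ.apply_eq_zero (x := 0) (by simp), hθ.apply_eq_zero (x := 1) (by simp)]
    ring

lemma isWeakDeriv_iteratedDeriv (k : ℕ) {f : ℝ → ℝ} (hf : ContDiff ℝ ∞ f) :
    IsWeakDeriv k f (iteratedDeriv k f) :=
  ⟨hf.continuous.locallyIntegrable.locallyIntegrableOn _,
    (hf.continuous_iteratedDeriv k
      (by exact_mod_cast le_top)).locallyIntegrable.locallyIntegrableOn _,
    fun _ hθ => integral_mul_iteratedDeriv_test k hf hθ⟩

/-- Weak derivatives are unique up to null sets of `(0,1)`. -/
lemma IsWeakDeriv.ae_eq {k : ℕ} {f g h : ℝ → ℝ} (hg : IsWeakDeriv k f g)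
    (hh : IsWeakDeriv k f h) : g =ᵐ[vol01] h := by
  have key := isOpen_Ioo.ae_eq_zero_of_integral_contDiff_smul_eq_zero (μ := volume)
    (hg.2.1.sub hh.2.1) fun θ h1 h2 h3 => by
    have hθ : IsTestFunction θ := ⟨h1, h2, h3⟩
    have hint : ∀ {u : ℝ → ℝ}, LocallyIntegrableOn u (Ioo (0 : ℝ) 1) →
        Integrable (fun x => u x * θ x) := fun {u} hu => by
      have h4 : IntegrableOn (fun x => u x * θ x) (tsupport θ) :=
        (hu.integrableOn_compact_subset h3 h2).mul_continuousOn h1.continuous.continuousOn h2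
      refine (integrableOn_iff_integrable_of_support_subset ?_).1 h4
      intro x hx
      exact subset_tsupport _ fun h0 => hx (by simp [h0])
    have hset : ∀ u : ℝ → ℝ, ∫ x, u x * θ x ∂vol01 = ∫ x, u x * θ x := fun u =>
      setIntegral_eq_integral_of_forall_compl_eq_zero fun x hx => by simp [hθ.apply_eq_zero hx]
    have e1 := hg.2.2 θ hθ
    rw [hh.2.2 θ hθ] at e1
    have e2 := mul_left_cancel₀ (pow_ne_zero k (by norm_num : (-1 : ℝ) ≠ 0)) e1
    rw [hset, hset] at e2
    calc ∫ x, θ x • (g - h) x = ∫ x, (g x * θ x - h x * θ x) := by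
          congr 1; ext x; simp; ring
      _ = 0 := by rw [integral_sub (hint hg.2.1) (hint hh.2.1), e2, sub_self]
  rw [vol01]
  filter_upwards [(ae_restrict_iff' measurableSet_Ioo).2 key] with x hx
  exact sub_eq_zero.1 hx

lemma weakDeriv_ae_eq (k : ℕ) {f : ℝ → ℝ} (hf : ContDiff ℝ ∞ f) :
    weakDeriv k f =ᵐ[vol01] iteratedDeriv k f := by
  have h : ∃ g, IsWeakDeriv k f g := ⟨_, isWeakDeriv_iteratedDeriv k hf⟩
  rw [weakDeriv, dif_pos h]
  exact h.choose_spec.ae_eq (isWeakDeriv_iteratedDeriv k hf)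

lemma memSobolev_of_contDiff (m : ℕ) {f : ℝ → ℝ} (hf : ContDiff ℝ ∞ f) : MemSobolev m f :=
  ⟨memLp_vol01 hf.continuous, fun k _ => ⟨_, isWeakDeriv_iteratedDeriv k hf,
    memLp_vol01 (hf.continuous_iteratedDeriv k (by exact_mod_cast le_top))⟩⟩

lemma hasTrace_weakDeriv (k : ℕ) {f : ℝ → ℝ} (hf : ContDiff ℝ ∞ f) (a : ℝ) :
    HasTrace (weakDeriv k f) a (iteratedDeriv k f a) :=
  ⟨_, (hf.continuous_iteratedDeriv k (by exact_mod_cast le_top)).continuousOn,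
    (weakDeriv_ae_eq k hf).symm, rfl⟩

/-! ### Cosine coefficients and matrix elements -/

/-- The coefficient `∫₀¹ f(x) cos(nπx) dx`. -/
noncomputable def cosCoeff (f : ℝ → ℝ) (n : ℕ) : ℝ :=
  ∫ x, f x * Real.cos (n * Real.pi * x) ∂vol01

/-- The function `2 cos(nπx)`, normalized such that for `n ≥ 1` its `n`-th cosine coefficient
is `1`. -/
noncomputable def cosine (n : ℕ) (x : ℝ) : ℝ := 2 * Real.cos (n * Real.pi * x)

lemma continuous_phi (j : ℕ) : Continuous (phi j) := by unfold phi; fun_prop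

lemma contDiff_cosine (n : ℕ) : ContDiff ℝ ∞ (cosine n) := by unfold cosine; fun_prop

lemma cosCoeff_add {f g : ℝ → ℝ} (hf : Continuous f) (hg : Continuous g) (n : ℕ) :
    cosCoeff (f + g) n = cosCoeff f n + cosCoeff g n := by
  unfold cosCoeff
  rw [← integral_add (integrable_vol01 (by fun_prop)) (integrable_vol01 (by fun_prop))]
  congr 1; ext x; simp; ring

lemma cosCoeff_smul (c : ℝ) (f : ℝ → ℝ) (n : ℕ) :
    cosCoeff (c • f) n = c * cosCoeff f n := by
  unfold cosCoeff
  rw [← integral_const_mul]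
  congr 1; ext x; simp; ring

/-- Since `φᵢφⱼ = cos((i-j)πx) - cos((i+j)πx)`, the matrix elements of a multiplication operator are
differences of cosine coefficients. -/
lemma ip_mul_phi_phi {f : ℝ → ℝ} (hf : Continuous f) (i j : ℕ) :
    ip (f * phi i) (phi j) = cosCoeff f ((i : ℤ) - j).natAbs - cosCoeff f (i + j) := by
  unfold cosCoeff ip
  rw [← integral_sub (integrable_vol01 (by fun_prop)) (integrable_vol01 (by fun_prop))]
  congr 1; ext x
  have h1 : Real.cos ((((i : ℤ) - j).natAbs : ℕ) * Real.pi * x)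
      = Real.cos (i * Real.pi * x - j * Real.pi * x) := by
    have : ((((i : ℤ) - j).natAbs : ℕ) : ℝ) = |(i : ℝ) - j| := by
      rw [← Int.cast_natCast, Int.natCast_natAbs]; push_cast; rfl
    rw [this]
    rcases abs_choice ((i : ℝ) - j) with h | h <;> rw [h]
    · ring_nf
    · rw [← Real.cos_neg]; ring_nf
  have h2 : ((i + j : ℕ) : ℝ) * Real.pi * x = i * Real.pi * x + j * Real.pi * x := by
    push_cast; ring
  rw [h1, h2, Real.cos_sub, Real.cos_add]
  have h3 : √(2 : ℝ) * √2 = 2 := Real.mul_self_sqrt (by norm_num)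
  simp only [Pi.mul_apply, phi]
  linear_combination (f x * Real.sin (i * Real.pi * x) * Real.sin (j * Real.pi * x)) * h3

lemma ip_mul_comm (f : ℝ → ℝ) (i j : ℕ) : ip (f * phi i) (phi j) = ip (f * phi j) (phi i) := by
  unfold ip
  congr 1; ext x; simp; ring

lemma integral_cos_int (m : ℤ) :
    ∫ x, Real.cos (m * Real.pi * x) ∂vol01 = if m = 0 then 1 else 0 := by
  rw [integral_vol01]
  split_ifs with h
  · simp [h]
  · have hm : (m : ℝ) * Real.pi ≠ 0 := mul_ne_zero (by exact_mod_cast h) Real.pi_ne_zero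
    rw [intervalIntegral.integral_comp_mul_left _ hm, integral_cos]
    simp [Real.sin_int_mul_pi]

lemma cosCoeff_cosine {m : ℕ} (hm : 1 ≤ m) (n : ℕ) :
    cosCoeff (cosine m) n = if n = m then 1 else 0 := by
  have h : ∀ x, cosine m x * Real.cos (n * Real.pi * x)
      = Real.cos (((m - n : ℤ) : ℝ) * Real.pi * x)
        + Real.cos (((m + n : ℤ) : ℝ) * Real.pi * x) := by
    intro x
    rw [cosine, show ((m - n : ℤ) : ℝ) * Real.pi * x = m * Real.pi * x - n * Real.pi * x by
      push_cast; ring, show ((m + n : ℤ) : ℝ) * Real.pi * x = m * Real.pi * x + n * Real.pi * x by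
      push_cast; ring, Real.cos_sub, Real.cos_add]
    ring
  simp only [cosCoeff, h]
  rw [integral_add (integrable_vol01 (by fun_prop)) (integrable_vol01 (by fun_prop)),
    integral_cos_int, integral_cos_int, if_neg (by omega : ¬ (m + n : ℤ) = 0), add_zero]
  congr 1
  simp only [eq_iff_iff]; omega

lemma cosCoeff_one (n : ℕ) : cosCoeff 1 n = if n = 0 then 1 else 0 := by
  have := integral_cos_int n
  simpa [cosCoeff] using this

/-! ### Admissible functions -/

/-- The space of smooth functions satisfying the boundary conditions of `HReg`, whose cosine
coefficients are `O(n⁻⁶)`. (The decay follows from the boundary conditions by integration by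
parts; it is part of the definition because it is explicit in all the examples needed.) -/
def admissible : Submodule ℝ (ℝ → ℝ) where
  carrier := {f | ContDiff ℝ ∞ f ∧ deriv f 0 = 0 ∧ deriv f 1 = 0 ∧
    iteratedDeriv 3 f 0 = 0 ∧ iteratedDeriv 3 f 1 = 0 ∧
    ∃ C : ℝ, ∀ n : ℕ, |cosCoeff f n| ≤ C / ((n : ℝ) + 1) ^ 6}
  zero_mem' := by
    refine ⟨contDiff_const, by simp, by simp, by simp, by simp, 0, fun n => ?_⟩
    simp [cosCoeff]
  add_mem' := by
    rintro f g ⟨hf, f0, f1, f2, f3, C, hC⟩ ⟨hg, g0, g1, g2, g3, D, hD⟩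
    have h3 : ∀ x, iteratedDeriv 3 (f + g) x = iteratedDeriv 3 f x + iteratedDeriv 3 g x :=
      fun x => iteratedDeriv_add (contDiff_infty.1 hf 3).contDiffAt
        (contDiff_infty.1 hg 3).contDiffAt
    have h1 : ∀ x, deriv (f + g) x = deriv f x + deriv g x := fun x =>
      deriv_add ((contDiff_infty_iff_deriv.1 hf).1 x) ((contDiff_infty_iff_deriv.1 hg).1 x)
    refine ⟨hf.add hg, by simp [*], by simp [*], by simp [*], by simp [*],
      C + D, fun n => ?_⟩
    rw [cosCoeff_add hf.continuous hg.continuous, add_div]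
    exact (abs_add_le _ _).trans (add_le_add (hC n) (hD n))
  smul_mem' := by
    rintro c f ⟨hf, f0, f1, f2, f3, C, hC⟩
    have h3 : ∀ x, iteratedDeriv 3 (c • f) x = c * iteratedDeriv 3 f x := fun x => by
      rw [iteratedDeriv_const_smul_field]; rfl
    have h1 : ∀ x, deriv (c • f) x = c * deriv f x := fun x => by
      rw [deriv_const_smul_field]; rfl
    refine ⟨hf.const_smul c, by simp [*], by simp [*], by simp [*], by simp [*],
      |c| * C, fun n => ?_⟩
    rw [cosCoeff_smul, abs_mul, mul_div_assoc]
    exact mul_le_mul_of_nonneg_left (hC n) (abs_nonneg _)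

lemma contDiff_of_mem {f : ℝ → ℝ} (hf : f ∈ admissible) : ContDiff ℝ ∞ f := hf.1

lemma hReg_of_mem {f : ℝ → ℝ} (hf : f ∈ admissible) : HReg f := by
  obtain ⟨h, h1, h2, h3, h4, -⟩ := hf
  rw [← iteratedDeriv_one] at h1 h2
  have key : ∀ {k : ℕ} {a : ℝ}, iteratedDeriv k f a = 0 → HasTrace (weakDeriv k f) a 0 :=
    fun {k a} h0 => h0 ▸ hasTrace_weakDeriv k h a
  exact ⟨memSobolev_of_contDiff 11 h, key h1, key h2, key h3, key h4⟩

lemma one_mem_admissible : (1 : ℝ → ℝ) ∈ admissible := by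
  have h : (1 : ℝ → ℝ) = fun _ => 1 := rfl
  refine ⟨contDiff_const, by simp [h], by simp [h], by simp [h, iteratedDeriv_const],
    by simp [h, iteratedDeriv_const], 1, fun n => ?_⟩
  rw [cosCoeff_one]
  split_ifs with hn
  · simp [hn]
  · rw [abs_zero]; positivity

lemma cosine_mem_admissible {n : ℕ} (hn : 1 ≤ n) : cosine n ∈ admissible := by
  have d1 : deriv (cosine n) = fun x => -(2 * (n * Real.pi)) * Real.sin (n * Real.pi * x) := by
    ext x
    have := (((hasDerivAt_id x).const_mul (n * Real.pi)).cos).const_mul 2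
    simp only [id] at this
    exact (this.congr_deriv (by ring)).deriv
  have d2 : deriv (fun x => -(2 * (n * Real.pi)) * Real.sin (n * Real.pi * x))
      = fun x => -(2 * (n * Real.pi) ^ 2) * Real.cos (n * Real.pi * x) := by
    ext x
    have := (((hasDerivAt_id x).const_mul (n * Real.pi)).sin).const_mul (-(2 * (n * Real.pi)))
    simp only [id] at this
    exact (this.congr_deriv (by ring)).deriv
  have d3 : deriv (fun x => -(2 * (n * Real.pi) ^ 2) * Real.cos (n * Real.pi * x))
      = fun x => (2 * (n * Real.pi) ^ 3) * Real.sin (n * Real.pi * x) := by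
    ext x
    have := (((hasDerivAt_id x).const_mul (n * Real.pi)).cos).const_mul (-(2 * (n * Real.pi) ^ 2))
    simp only [id] at this
    exact (this.congr_deriv (by ring)).deriv
  have e3 : iteratedDeriv 3 (cosine n) = fun x => (2 * (n * Real.pi) ^ 3) *
      Real.sin (n * Real.pi * x) := by
    rw [iteratedDeriv_eq_iterate]
    simp only [Function.iterate_succ, Function.iterate_zero, Function.comp, id]
    rw [d1, d2, d3]
  refine ⟨contDiff_cosine n, by simp [d1], by simp [d1], by simp [e3], by simp [e3],
    ((n : ℝ) + 1) ^ 6, fun m => ?_⟩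
  rw [cosCoeff_cosine hn]
  split_ifs with h
  · subst h; rw [abs_one, div_self (by positivity)]
  · rw [abs_zero]; positivity

/-- The polynomial `(π⁶/720)(x⁶ - 5x⁴ + 7x²)`; up to scaling and constants, it is the even
polynomial of degree six whose derivatives of order one and three vanish at `1`. -/
noncomputable def sextic (x : ℝ) : ℝ := Real.pi ^ 6 / 720 * (x ^ 6 - 5 * x ^ 4 + 7 * x ^ 2)

/-- Integrating by parts until the polynomial is exhausted, only the boundary term with the fifth
derivative survives. -/
lemma cosCoeff_sextic {n : ℕ} (hn : 1 ≤ n) : cosCoeff sextic n = (-1) ^ n / (n : ℝ) ^ 6 := by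
  have hpi := Real.pi_ne_zero
  have hn0 : (n : ℝ) ≠ 0 := by exact_mod_cast (by omega : n ≠ 0)
  obtain ⟨a, ha⟩ : ∃ a : ℝ, a = n * Real.pi := ⟨_, rfl⟩
  have ha0 : a ≠ 0 := by rw [ha]; exact mul_ne_zero hn0 hpi
  have hpoly : ∀ (x c₀ c₁ c₂ c₃ c₄ c₅ c₆ : ℝ), HasDerivAt
      (fun x : ℝ => c₀ + c₁ * x + c₂ * x ^ 2 + c₃ * x ^ 3 + c₄ * x ^ 4 + c₅ * x ^ 5 + c₆ * x ^ 6)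
      (c₁ + 2 * c₂ * x + 3 * c₃ * x ^ 2 + 4 * c₄ * x ^ 3 + 5 * c₅ * x ^ 4 + 6 * c₆ * x ^ 5) x := by
    intro x c₀ c₁ c₂ c₃ c₄ c₅ c₆
    have h := ((((((hasDerivAt_const x c₀).add ((hasDerivAt_id x).const_mul c₁)).add
      ((hasDerivAt_pow 2 x).const_mul c₂)).add ((hasDerivAt_pow 3 x).const_mul c₃)).add
      ((hasDerivAt_pow 4 x).const_mul c₄)).add ((hasDerivAt_pow 5 x).const_mul c₅)).add
      ((hasDerivAt_pow 6 x).const_mul c₆)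
    exact h.congr_deriv (by push_cast; ring)
  -- `S` and `T` are the factors of `sin` and `cos` in a primitive
  obtain ⟨S, hS⟩ : ∃ S : ℝ → ℝ, S = fun x => (-14 / a ^ 3 - 120 / a ^ 5 - 720 / a ^ 7) + 0 * x
    + (7 / a + 60 / a ^ 3 + 360 / a ^ 5) * x ^ 2 + 0 * x ^ 3 + (-5 / a - 30 / a ^ 3) * x ^ 4
    + 0 * x ^ 5 + 1 / a * x ^ 6 := ⟨_, rfl⟩
  obtain ⟨T, hT⟩ : ∃ T : ℝ → ℝ, T = fun x => 0 + (14 / a ^ 2 + 120 / a ^ 4 + 720 / a ^ 6) * x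
    + 0 * x ^ 2 + (-20 / a ^ 2 - 120 / a ^ 4) * x ^ 3 + 0 * x ^ 4 + 6 / a ^ 2 * x ^ 5
    + 0 * x ^ 6 := ⟨_, rfl⟩
  have hF : ∀ x ∈ uIcc (0 : ℝ) 1, HasDerivAt
      (fun x => S x * Real.sin (a * x) + T x * Real.cos (a * x))
      ((x ^ 6 - 5 * x ^ 4 + 7 * x ^ 2) * Real.cos (a * x)) x := by
    intro x _
    have hs := ((hasDerivAt_id x).const_mul a).sin
    have hc := ((hasDerivAt_id x).const_mul a).cos
    have hS' := hpoly x (-14 / a ^ 3 - 120 / a ^ 5 - 720 / a ^ 7) 0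
      (7 / a + 60 / a ^ 3 + 360 / a ^ 5) 0 (-5 / a - 30 / a ^ 3) 0 (1 / a)
    have hT' := hpoly x 0 (14 / a ^ 2 + 120 / a ^ 4 + 720 / a ^ 6) 0
      (-20 / a ^ 2 - 120 / a ^ 4) 0 (6 / a ^ 2) 0
    rw [← hS] at hS'
    rw [← hT] at hT'
    refine ((hS'.mul hs).add (hT'.mul hc)).congr_deriv ?_
    simp only [id, hS, hT]
    field_simp
    ring
  have hint : ∫ x in (0 : ℝ)..1, (x ^ 6 - 5 * x ^ 4 + 7 * x ^ 2) * Real.cos (a * x)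
      = 720 * (-1) ^ n / a ^ 6 := by
    rw [intervalIntegral.integral_eq_sub_of_hasDerivAt hF
      (Continuous.intervalIntegrable (by fun_prop) _ _)]
    simp only [mul_zero, mul_one, Real.sin_zero, Real.cos_zero]
    rw [ha, Real.sin_nat_mul_pi, Real.cos_nat_mul_pi, ← ha]
    simp only [hT]
    field_simp
    ring
  rw [cosCoeff, integral_vol01]
  simp only [sextic, mul_assoc, intervalIntegral.integral_const_mul]
  simp only [← mul_assoc, ← ha]
  rw [hint, ha]
  field_simp

lemma sextic_mem_admissible : sextic ∈ admissible := by
  have d1 : deriv sextic = fun x => Real.pi ^ 6 / 720 * (6 * x ^ 5 - 20 * x ^ 3 + 14 * x) := by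
    ext x
    have h := ((((hasDerivAt_pow 6 x).sub ((hasDerivAt_pow 4 x).const_mul 5)).add
      ((hasDerivAt_pow 2 x).const_mul 7))).const_mul (Real.pi ^ 6 / 720)
    exact (h.congr_deriv (by push_cast; ring)).deriv
  have d2 : deriv (fun x : ℝ => Real.pi ^ 6 / 720 * (6 * x ^ 5 - 20 * x ^ 3 + 14 * x))
      = fun x => Real.pi ^ 6 / 720 * (30 * x ^ 4 - 60 * x ^ 2 + 14) := by
    ext x
    have h := (((((hasDerivAt_pow 5 x).const_mul 6).sub ((hasDerivAt_pow 3 x).const_mul 20)).add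
      ((hasDerivAt_id x).const_mul 14))).const_mul (Real.pi ^ 6 / 720)
    exact (h.congr_deriv (by push_cast; ring)).deriv
  have d3 : deriv (fun x : ℝ => Real.pi ^ 6 / 720 * (30 * x ^ 4 - 60 * x ^ 2 + 14))
      = fun x => Real.pi ^ 6 / 720 * (120 * x ^ 3 - 120 * x) := by
    ext x
    have h := ((((hasDerivAt_pow 4 x).const_mul 30).sub
      ((hasDerivAt_pow 2 x).const_mul 60)).add_const 14).const_mul (Real.pi ^ 6 / 720)
    exact (h.congr_deriv (by push_cast; ring)).deriv
  have e3 : iteratedDeriv 3 sextic = fun x => Real.pi ^ 6 / 720 * (120 * x ^ 3 - 120 * x) := by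
    rw [iteratedDeriv_eq_iterate]
    simp only [Function.iterate_succ, Function.iterate_zero, Function.comp, id]
    rw [d1, d2, d3]
  refine ⟨by unfold sextic; fun_prop, by simp [d1], by norm_num [d1], by simp [e3], by simp [e3],
    |cosCoeff sextic 0| + 64, fun n => ?_⟩
  rcases Nat.eq_zero_or_pos n with rfl | hn
  · simp
  · have hn' : (1 : ℝ) ≤ n := by exact_mod_cast hn
    rw [cosCoeff_sextic hn, abs_div, abs_pow, abs_neg, abs_one, one_pow, abs_of_pos (by positivity),
      div_le_div_iff₀ (by positivity) (by positivity)]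
    calc 1 * ((n : ℝ) + 1) ^ 6 ≤ (2 * (n : ℝ)) ^ 6 := by rw [one_mul]; gcongr; linarith
      _ = 64 * (n : ℝ) ^ 6 := by ring
      _ ≤ _ := by gcongr; linarith [abs_nonneg (cosCoeff sextic 0)]

/-! ### Summability of the series -/

lemma exists_abs_ip_le_of_mem {f : ℝ → ℝ} (hf : f ∈ admissible) (i : ℕ) :
    ∃ C : ℝ, 0 ≤ C ∧ ∀ j : ℕ+, |ip (f * phi i) (phi j)| ≤ C / (j : ℝ) ^ 6 := by
  obtain ⟨C, hC⟩ := hf.2.2.2.2.2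
  have hC0 : 0 ≤ C := by simpa using (abs_nonneg _).trans (hC 0)
  refine ⟨2 * (C * ((i : ℝ) + 1) ^ 6), by positivity, fun j => ?_⟩
  have hj : (0 : ℝ) < j := by exact_mod_cast j.pos
  have key : ∀ n : ℕ, (j : ℕ) ≤ (i + 1) * (n + 1) →
      |cosCoeff f n| ≤ C * ((i : ℝ) + 1) ^ 6 / (j : ℝ) ^ 6 := fun n hn => by
    refine (hC n).trans ?_
    rw [div_le_div_iff₀ (by positivity) (by positivity), mul_assoc, ← mul_pow]
    have : ((j : ℕ) : ℝ) ≤ (i + 1) * (n + 1) := by exact_mod_cast hn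
    gcongr
  rw [ip_mul_phi_phi hf.1.continuous]
  refine (abs_sub _ _).trans ((add_le_add (key _ ?_) (key _ ?_)).trans (le_of_eq (by ring)))
  · obtain ⟨d, hd⟩ : ∃ d, d = ((i : ℤ) - (j : ℕ)).natAbs := ⟨_, rfl⟩
    rw [← hd]
    have : (j : ℕ) ≤ i + d := by omega
    nlinarith [Nat.zero_le (i * d)]
  · nlinarith [Nat.zero_le (i * i), Nat.zero_le (i * (j : ℕ))]

lemma exists_abs_ip_le {g : ℝ → ℝ} (hg : Continuous g) (i : ℕ) :
    ∃ C : ℝ, 0 ≤ C ∧ ∀ j : ℕ+, |ip (g * phi i) (phi j)| ≤ C := by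
  have key : ∀ n, |cosCoeff g n| ≤ ∫ x, |g x| ∂vol01 := fun n => by
    refine (abs_integral_le_integral_abs).trans
      (integral_mono (integrable_vol01 (by fun_prop)) (integrable_vol01 (by fun_prop)) fun x => ?_)
    simp only [abs_mul]
    exact mul_le_of_le_one_right (abs_nonneg _) (Real.abs_cos_le_one _)
  refine ⟨2 * ∫ x, |g x| ∂vol01, mul_nonneg zero_le_two (integral_nonneg fun x => abs_nonneg _),
    fun j => ?_⟩
  rw [ip_mul_phi_phi hg, two_mul]
  exact (abs_sub _ _).trans (add_le_add (key _) (key _))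

lemma exists_abs_lam_sub_le (s : ℝ) :
    ∃ D : ℝ, 1 ≤ D ∧ ∀ j : ℕ+, |lam j - s| ≤ D * (j : ℝ) ^ 2 := by
  refine ⟨Real.pi ^ 2 + |s| + 1, by nlinarith [abs_nonneg s, sq_nonneg Real.pi], fun j => ?_⟩
  have hj : (1 : ℝ) ≤ (j : ℝ) ^ 2 := one_le_pow₀ (by exact_mod_cast j.pos)
  refine (abs_sub _ _).trans ?_
  rw [lam, abs_of_nonneg (by positivity)]
  nlinarith [abs_nonneg s, mul_nonneg (abs_nonneg s) (sub_nonneg.2 hj)]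

lemma summable_of_abs_le {u : ℕ+ → ℝ} {C : ℝ} (h : ∀ j, |u j| ≤ C / (j : ℝ) ^ 2) : Summable u := by
  have h1 : Summable fun j : ℕ+ => (((j : ℕ) : ℝ) ^ 2)⁻¹ :=
    ((Real.summable_nat_pow_inv (p := 2)).2 (by norm_num)).comp_injective PNat.coe_injective
  refine Summable.of_norm_bounded (h1.mul_left C) fun j => ?_
  rw [Real.norm_eq_abs, ← div_eq_mul_inv]
  exact h j

/-- The weight of the `j`-th term of the series `A^p_K`, sign `(-1)^(p-1)` excluded. -/
noncomputable def quadWeight (p K j : ℕ) : ℝ :=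
  (lam j - (lam 1 + lam K) / 2) * (lam K - lam j) ^ (p - 1) * (lam j - lam 1) ^ (p - 1)

lemma exists_abs_quadWeight_le {p : ℕ} (hp : p ≤ 3) (K : ℕ) :
    ∃ D : ℝ, 0 ≤ D ∧ ∀ j : ℕ+, |quadWeight p K j| ≤ D * (j : ℝ) ^ 10 := by
  obtain ⟨D₁, h₁, H₁⟩ := exists_abs_lam_sub_le ((lam 1 + lam K) / 2)
  obtain ⟨D₂, h₂, H₂⟩ := exists_abs_lam_sub_le (lam K)
  obtain ⟨D₃, h₃, H₃⟩ := exists_abs_lam_sub_le (lam 1)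
  refine ⟨D₁ * D₂ ^ 2 * D₃ ^ 2, by positivity, fun j => ?_⟩
  have hj : (1 : ℝ) ≤ j := by exact_mod_cast j.pos
  have hpow : ∀ {D y : ℝ}, 1 ≤ D → |y| ≤ D * (j : ℝ) ^ 2 →
      |y| ^ (p - 1) ≤ (D * (j : ℝ) ^ 2) ^ 2 := fun {D y} hD hy =>
    (pow_le_pow_left₀ (abs_nonneg _) hy _).trans
      (pow_le_pow_right₀ (one_le_mul_of_one_le_of_one_le hD (one_le_pow₀ hj)) (by omega))
  rw [quadWeight, abs_mul, abs_mul, abs_pow, abs_pow, abs_sub_comm (lam K)]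
  calc _ ≤ (D₁ * (j : ℝ) ^ 2) * (D₂ * (j : ℝ) ^ 2) ^ 2 * (D₃ * (j : ℝ) ^ 2) ^ 2 := by
        gcongr
        · exact H₁ j
        · exact hpow h₂ (H₂ j)
        · exact hpow h₃ (H₃ j)
    _ = _ := by ring

/-- For `p ≤ 3` the weights are `O(j¹⁰)`, and each of the two matrix elements is `O(j⁻⁶)`. -/
lemma summable_quad {p : ℕ} (hp : p ≤ 3) (K : ℕ) {f g : ℝ → ℝ} (hf : f ∈ admissible)
    (hg : g ∈ admissible) :
    Summable fun j : ℕ+ => quadWeight p K j * ip (f * phi 1) (phi j) * ip (g * phi K) (phi j) := by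
  obtain ⟨D, h₁, H₁⟩ := exists_abs_quadWeight_le hp K
  obtain ⟨C, h₂, H₂⟩ := exists_abs_ip_le_of_mem hf 1
  obtain ⟨C', h₃, H₃⟩ := exists_abs_ip_le_of_mem hg K
  refine summable_of_abs_le (C := D * C * C') fun j => ?_
  have hj : (0 : ℝ) < j := by exact_mod_cast j.pos
  rw [abs_mul, abs_mul]
  calc _ ≤ (D * (j : ℝ) ^ 10) * (C / (j : ℝ) ^ 6) * (C' / (j : ℝ) ^ 6) := by
        gcongr
        · exact H₁ j
        · exact H₂ j
        · exact H₃ j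
    _ = _ := by field_simp

lemma summable_cub (s : ℝ) (i k : ℕ) {f g : ℝ → ℝ} (hf : f ∈ admissible) (hg : Continuous g) :
    Summable fun j : ℕ+ => (lam j - s) * ip (f * phi i) (phi j) * ip (g * phi k) (phi j) := by
  obtain ⟨D, h₁, H₁⟩ := exists_abs_lam_sub_le s
  obtain ⟨C, h₂, H₂⟩ := exists_abs_ip_le_of_mem hf i
  obtain ⟨C', h₃, H₃⟩ := exists_abs_ip_le hg k
  refine summable_of_abs_le (C := D * C * C') fun j => ?_
  have hj : (1 : ℝ) ≤ j := by exact_mod_cast j.pos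
  rw [abs_mul, abs_mul]
  calc _ ≤ (D * (j : ℝ) ^ 2) * (C / (j : ℝ) ^ 6) * C' := by
        gcongr
        · exact H₁ j
        · exact H₂ j
        · exact H₃ j
    _ = D * C * C' / (j : ℝ) ^ 4 := by field_simp
    _ ≤ _ := by gcongr; norm_num

/-! ### Expansion of the coefficients in finite linear combinations -/

lemma ip_sum_mul {ι : Type*} [Fintype ι] (x : ι → ℝ) {F : ι → ℝ → ℝ} (hF : ∀ i, Continuous (F i))
    (k j : ℕ) :
    ip ((∑ i, x i • F i) * phi k) (phi j) = ∑ i, x i * ip (F i * phi k) (phi j) := by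
  have := continuous_phi k
  have := continuous_phi j
  unfold ip
  simp only [← integral_const_mul]
  rw [← integral_finsetSum _ fun i _ => ?_]
  · congr 1; ext y
    simp only [Pi.mul_apply, Finset.sum_apply, Pi.smul_apply, smul_eq_mul, Finset.sum_mul,
      mul_assoc]
  · have := hF i
    exact integrable_vol01 (by simp only [Pi.mul_apply]; fun_prop)

lemma ip_weakDeriv_sq_mul {f : ℝ → ℝ} (hf : ContDiff ℝ ∞ f) (k j : ℕ) :
    ip (weakDeriv 1 f ^ 2 * phi k) (phi j) = ip (deriv f ^ 2 * phi k) (phi j) := by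
  refine integral_congr_ae ?_
  filter_upwards [weakDeriv_ae_eq 1 hf] with x hx
  simp only [Pi.mul_apply, Pi.pow_apply, hx, iteratedDeriv_one]

lemma deriv_sum_sq {ι : Type*} [Fintype ι] (x : ι → ℝ) {F : ι → ℝ → ℝ}
    (hF : ∀ i, ContDiff ℝ ∞ (F i)) :
    deriv (∑ i, x i • F i) ^ 2
      = ∑ q : ι × ι, (x q.1 * x q.2) • (deriv (F q.1) * deriv (F q.2)) := by
  have h : deriv (∑ i, x i • F i) = ∑ i, x i • deriv (F i) := by
    ext y
    have := HasDerivAt.sum (u := Finset.univ) (A := fun i => x i • F i)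
      (A' := fun i => x i • deriv (F i) y) (x := y) fun i _ =>
        ((contDiff_infty_iff_deriv.1 (hF i)).1 y).hasDerivAt.const_smul (x i)
    rw [this.deriv]; simp
  rw [h, sq, Finset.sum_mul_sum, ← Finset.univ_product_univ, Finset.sum_product]
  refine Finset.sum_congr rfl fun i _ => Finset.sum_congr rfl fun k _ => ?_
  ext y; simp; ring

lemma hasSum_mul_sum_sum {ι κ : Type*} [Fintype ι] [Fintype κ] (g : ℕ+ → ℝ) (x : ι → ℝ)
    (z : κ → ℝ) {u : ι → ℕ+ → ℝ} {w : κ → ℕ+ → ℝ}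
    (h : ∀ i k, Summable fun j => g j * u i j * w k j) :
    HasSum (fun j => g j * (∑ i, x i * u i j) * ∑ k, z k * w k j)
      (∑ i, ∑ k, x i * z k * ∑' j, g j * u i j * w k j) := by
  have := hasSum_sum (s := Finset.univ) fun i _ => hasSum_sum (s := Finset.univ) fun k _ =>
    ((h i k).hasSum.mul_left (x i * z k))
  refine this.congr_fun fun j => ?_
  rw [mul_assoc, Finset.sum_mul_sum, Finset.mul_sum]
  refine Finset.sum_congr rfl fun i _ => ?_
  rw [Finset.mul_sum]
  exact Finset.sum_congr rfl fun k _ => by ring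

/-- The bilinear form which gives `A^p_K` on the diagonal, up to the sign. -/
noncomputable def quadForm (p K : ℕ) (f g : ℝ → ℝ) : ℝ :=
  ∑' j : ℕ+, quadWeight p K j * ip (f * phi 1) (phi j) * ip (g * phi K) (phi j)

lemma quadCoeff_sum {ι : Type*} [Fintype ι] {p : ℕ} (hp : p ≤ 3) (K : ℕ) (x : ι → ℝ)
    {F : ι → ℝ → ℝ} (hF : ∀ i, F i ∈ admissible) :
    quadCoeff p K (∑ i, x i • F i)
      = (-1) ^ (p - 1) * ∑ i, ∑ k, x i * x k * quadForm p K (F i) (F k) := by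
  rw [quadCoeff]
  congr 1
  refine Eq.trans (tsum_congr fun j => ?_) (hasSum_mul_sum_sum (fun j : ℕ+ => quadWeight p K j) x x
    fun i k => summable_quad hp K (hF i) (hF k)).tsum_eq
  rw [quadTerm, ip_sum_mul x fun i => (hF i).1.continuous,
    ip_sum_mul x fun i => (hF i).1.continuous, quadWeight]

/-- The coefficient `C_K` is a homogeneous cubic polynomial in the amplitudes of a linear
combination. -/
lemma continuous_cubCoeff_sum {ι : Type*} [Fintype ι] (K : ℕ) {F : ι → ℝ → ℝ}
    (hF : ∀ i, F i ∈ admissible) :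
    Continuous fun x : ι → ℝ => cubCoeff K (∑ i, x i • F i) := by
  have hD : ∀ q : ι × ι, Continuous (deriv (F q.1) * deriv (F q.2)) := fun q =>
    (contDiff_infty_iff_deriv.1 (hF q.1).1).2.continuous.mul
      (contDiff_infty_iff_deriv.1 (hF q.2).1).2.continuous
  have hsum : ∀ x : ι → ℝ, ContDiff ℝ ∞ (∑ i, x i • F i) := fun x =>
    contDiff_of_mem (Submodule.sum_mem _ fun i _ => Submodule.smul_mem _ _ (hF i))
  have key : ∀ (s : ℝ) (a b : ℕ), ∃ c : ι → ι × ι → ℝ, ∀ x : ι → ℝ,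
      ∑' j : ℕ+, (lam j - s) * ip ((∑ i, x i • F i) * phi a) (phi j) *
        ip (weakDeriv 1 (∑ i, x i • F i) ^ 2 * phi b) (phi j)
      = ∑ i, ∑ q : ι × ι, x i * (x q.1 * x q.2) * c i q := by
    intro s a b
    refine ⟨fun i q => ∑' j : ℕ+, (lam j - s) * ip (F i * phi a) (phi j) *
      ip ((deriv (F q.1) * deriv (F q.2)) * phi b) (phi j), fun x => ?_⟩
    refine Eq.trans (tsum_congr fun j => ?_) (hasSum_mul_sum_sum (fun j : ℕ+ => lam j - s) x
      (fun q : ι × ι => x q.1 * x q.2) fun i q => summable_cub s a b (hF i) (hD q)).tsum_eq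
    rw [ip_weakDeriv_sq_mul (hsum x), deriv_sum_sq x fun i => (hF i).1, ip_sum_mul _ hD,
      ip_sum_mul x fun i => (hF i).1.continuous]
  obtain ⟨c, hc⟩ := key (lam 1) 1 K
  obtain ⟨d, hd⟩ := key (lam K) K 1
  have e : ∀ x : ι → ℝ, cubCoeff K (∑ i, x i • F i)
      = -(∑ i, ∑ q : ι × ι, x i * (x q.1 * x q.2) * c i q)
        - ∑ i, ∑ q : ι × ι, x i * (x q.1 * x q.2) * d i q := fun x => by
    rw [cubCoeff, ← hc, ← hd, ← tsum_neg]
    congr 1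
    · exact tsum_congr fun j => by rw [cubTerm₁]; ring
    · exact tsum_congr fun j => by rw [cubTerm₂, ip_mul_comm _ (j : ℕ) K]
  simp only [e]
  fun_prop

lemma summable_quadTerm {p : ℕ} (hp : p ≤ 3) (K : ℕ) {f : ℝ → ℝ} (hf : f ∈ admissible) :
    Summable fun j : ℕ+ => quadTerm p K f j :=
  summable_quad hp K hf hf

lemma summable_cubTerm (K : ℕ) {f : ℝ → ℝ} (hf : f ∈ admissible) :
    (Summable fun j : ℕ+ => cubTerm₁ K f j) ∧ Summable fun j : ℕ+ => cubTerm₂ K f j := by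
  have hc : Continuous (deriv f ^ 2) := (contDiff_infty_iff_deriv.1 hf.1).2.continuous.pow 2
  constructor
  · refine (summable_cub (lam 1) 1 K hf hc).neg.congr fun j => ?_
    rw [cubTerm₁, ip_weakDeriv_sq_mul hf.1]; ring
  · refine (summable_cub (lam K) K 1 hf hc).congr fun j => ?_
    rw [cubTerm₂, ip_weakDeriv_sq_mul hf.1, ip_mul_comm f (j : ℕ) K]

/-! ### Values of the forms on cosines -/

lemma ip_cosine_mul {n i j : ℕ} (hi : i < n) (hj : 1 ≤ j) :
    ip (cosine n * phi i) (phi j) = (if j = n + i then 1 else 0) - if j + i = n then 1 else 0 := by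
  rw [ip_mul_phi_phi (contDiff_cosine n).continuous, cosCoeff_cosine (by omega),
    cosCoeff_cosine (by omega)]
  congr 2
  · simp only [eq_iff_iff]; omega
  · simp only [eq_iff_iff]; omega

/-- For `i < n` the matrix elements `⟨2 cos(nπx) φᵢ, φⱼ⟩` are `1` for `j = n + i`, `-1` for
`j = n - i`, and `0` otherwise. -/
lemma hasSum_mul_ip_cosine {n i : ℕ} (hi : i < n) (g : ℕ → ℝ) :
    HasSum (fun j : ℕ+ => g j * ip (cosine n * phi i) (phi j)) (g (n + i) - g (n - i)) := by
  have key : ∀ m : ℕ, 1 ≤ m → HasSum (fun j : ℕ+ => g j * if (j : ℕ) = m then 1 else 0) (g m) := by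
    intro m hm
    have := hasSum_ite_eq (⟨m, hm⟩ : ℕ+) (g m)
    refine this.congr_fun fun j => ?_
    by_cases h : (j : ℕ) = m
    · have : j = ⟨m, hm⟩ := PNat.eq h
      simp [this]
    · have : j ≠ ⟨m, hm⟩ := fun h' => h (by rw [h'])
      simp only [if_neg this, mul_ite, mul_one, mul_zero]
      exact if_neg h
  refine ((key (n + i) (by omega)).sub (key (n - i) (by omega))).congr_fun fun j => ?_
  rw [ip_cosine_mul hi j.pos, mul_sub]
  congr 3
  simp only [eq_iff_iff]; omega

lemma quadForm_cosine (p : ℕ) {K m n : ℕ} (hm : 2 ≤ m) (hn : K < n) :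
    quadForm p K (cosine m) (cosine n)
      = quadWeight p K (m + 1) *
          ((if m + 1 = n + K then 1 else 0) - if m + 1 + K = n then 1 else 0)
        - quadWeight p K (m - 1) *
          ((if m - 1 = n + K then 1 else 0) - if m - 1 + K = n then 1 else 0) := by
  have h := hasSum_mul_ip_cosine (show 1 < m by omega)
    fun j => quadWeight p K j * ip (cosine n * phi K) (phi j)
  rw [ip_cosine_mul hn (by omega), ip_cosine_mul hn (by omega)] at h
  rw [quadForm, ← h.tsum_eq]
  exact tsum_congr fun j => by ring

/-! ### A function with nonvanishing linear coefficients -/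

lemma one_div_pow_seven_le {m : ℝ} (hm : 0 < m) {r : ℝ} (hr : m + 1 ≤ r) :
    1 / (m + 1) ^ 7 ≤ 1 / m ^ 6 - 1 / r ^ 6 := by
  have h1 : 1 / r ^ 6 ≤ 1 / (m + 1) ^ 6 := by gcongr
  have h2 : 1 / (m + 1) ^ 7 ≤ 1 / m ^ 6 - 1 / (m + 1) ^ 6 := by
    have e : 1 / m ^ 6 - 1 / (m + 1) ^ 6 - 1 / (m + 1) ^ 7
        = (5 * m ^ 6 + 21 * m ^ 5 + 35 * m ^ 4 + 35 * m ^ 3 + 21 * m ^ 2 + 7 * m + 1)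
          / (m ^ 6 * (m + 1) ^ 7) := by
      field_simp; ring
    have : 0 ≤ 1 / m ^ 6 - 1 / (m + 1) ^ 6 - 1 / (m + 1) ^ 7 := by rw [e]; positivity
    linarith
  linarith

/-- Modifying the coefficients of `sextic` at the frequencies `0` and `K - 1` produces a function
satisfying `HLin`. -/
lemma exists_linear_background {K : ℕ} (hK : 2 ≤ K) :
    ∃ f ∈ admissible, ip (f * phi 1) (phi K) = 0 ∧
      ∀ j : ℕ, 1 ≤ j → j ≠ K → 1 / (j : ℝ) ^ 7 ≤ |ip (f * phi 1) (phi j)| := by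
  obtain ⟨κ, hκ⟩ : ∃ κ : ℝ,
      κ = (-1) ^ (K + 1) / ((K + 1 : ℕ) : ℝ) ^ 6 - (-1) ^ (K - 1) / ((K - 1 : ℕ) : ℝ) ^ 6 :=
    ⟨_, rfl⟩
  obtain ⟨h, hh⟩ : ∃ h : ℝ, h = 1 + cosCoeff (sextic + κ • cosine (K - 1)) 2
      - cosCoeff (sextic + κ • cosine (K - 1)) 0 := ⟨_, rfl⟩
  have hcos := cosine_mem_admissible (show 1 ≤ K - 1 by omega)
  have hg := admissible.add_mem sextic_mem_admissible (admissible.smul_mem κ hcos)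
  have hf := admissible.add_mem hg (admissible.smul_mem h one_mem_admissible)
  have hc0 : ∀ n, cosCoeff (sextic + κ • cosine (K - 1) + h • 1) n
      = cosCoeff (sextic + κ • cosine (K - 1)) n + h * if n = 0 then 1 else 0 := fun n => by
    rw [cosCoeff_add hg.1.continuous (admissible.smul_mem h one_mem_admissible).1.continuous,
      cosCoeff_smul, cosCoeff_one]
  have hc : ∀ n, 1 ≤ n → cosCoeff (sextic + κ • cosine (K - 1) + h • 1) n
      = (-1) ^ n / (n : ℝ) ^ 6 + κ * if n = K - 1 then 1 else 0 := fun n hn => by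
    rw [hc0, cosCoeff_add sextic_mem_admissible.1.continuous
      (admissible.smul_mem κ hcos).1.continuous, cosCoeff_sextic hn, cosCoeff_smul,
      cosCoeff_cosine (by omega), if_neg (show ¬ n = 0 by omega)]
    ring
  have hK1 : cosCoeff (sextic + κ • cosine (K - 1) + h • 1) (K - 1)
      = (-1) ^ (K + 1) / ((K + 1 : ℕ) : ℝ) ^ 6 := by
    rw [hc _ (by omega), if_pos rfl, hκ]; ring
  refine ⟨_, hf, ?_, fun j hj hjK => ?_⟩
  · rw [ip_mul_phi_phi hf.1.continuous, show (((1 : ℕ) : ℤ) - K).natAbs = K - 1 by omega, hK1,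
      hc _ (by omega), if_neg (by omega), add_comm 1 K]
    ring
  rw [ip_mul_phi_phi hf.1.continuous, show (((1 : ℕ) : ℤ) - j).natAbs = j - 1 by omega]
  obtain ⟨m, rfl⟩ : ∃ m, j = m + 1 := ⟨j - 1, by omega⟩
  rw [show m + 1 - 1 = m by omega, show 1 + (m + 1) = m + 2 by omega]
  rcases Nat.eq_zero_or_pos m with rfl | hm
  · rw [hc0, hc0, if_pos rfl, if_neg (by omega), hh]
    norm_num
  have hm' : (0 : ℝ) < m := by exact_mod_cast hm
  -- both coefficients have the sign `(-1)^m`, and they decrease in absolute value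
  obtain ⟨r, hr, e⟩ : ∃ r : ℝ, (m : ℝ) + 1 ≤ r ∧
      cosCoeff (sextic + κ • cosine (K - 1) + h • 1) (m + 2) = (-1) ^ m / r ^ 6 := by
    by_cases hmK : m + 2 = K - 1
    · refine ⟨m + 4, by linarith, ?_⟩
      rw [hmK, hK1, show K + 1 = m + 4 by omega, pow_add]
      push_cast; norm_num
    · refine ⟨m + 2, by linarith, ?_⟩
      rw [hc _ (by omega), if_neg hmK, pow_add]
      push_cast; norm_num
  rw [e, hc m hm, if_neg (by omega), mul_zero, add_zero,
    show (-1 : ℝ) ^ m / (m : ℝ) ^ 6 - (-1) ^ m / r ^ 6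
      = (-1) ^ m * (1 / (m : ℝ) ^ 6 - 1 / r ^ 6) by ring,
    abs_mul, abs_pow, abs_neg, abs_one, one_pow, one_mul]
  push_cast
  exact (one_div_pow_seven_le hm' hr).trans (le_abs_self _)

/-! ### The cubic coefficient of a sum of two cosines -/

lemma cosCoeff_deriv_sq {m d n : ℕ} (hm : 1 ≤ m) (hd : 1 ≤ d) (hn : 1 ≤ n) :
    cosCoeff (deriv (cosine m + cosine (m + d)) ^ 2) n
      = Real.pi ^ 2 * (-(m : ℝ) ^ 2 * (if n = 2 * m then 1 else 0)
        - ((m + d : ℕ) : ℝ) ^ 2 * (if n = 2 * (m + d) then 1 else 0)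
        + 2 * m * ((m + d : ℕ) : ℝ) * (if n = d then 1 else 0)
        - 2 * m * ((m + d : ℕ) : ℝ) * (if n = 2 * m + d then 1 else 0)) := by
  have h1 : deriv (cosine m + cosine (m + d)) = fun x =>
      -(2 * Real.pi) * (m * Real.sin (m * Real.pi * x)
        + ((m + d : ℕ) : ℝ) * Real.sin (((m + d : ℕ) : ℝ) * Real.pi * x)) := by
    ext x
    have e1 := (((hasDerivAt_id x).const_mul (m * Real.pi)).cos).const_mul 2
    have e2 := (((hasDerivAt_id x).const_mul (((m + d : ℕ) : ℝ) * Real.pi)).cos).const_mul 2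
    have e3 := e1.add e2
    simp only [id] at e3
    exact (e3.congr_deriv (by ring)).deriv
  have h2 : deriv (cosine m + cosine (m + d)) ^ 2
      = (2 * Real.pi ^ 2 * ((m : ℝ) ^ 2 + ((m + d : ℕ) : ℝ) ^ 2)) • (1 : ℝ → ℝ)
        + ((-(Real.pi ^ 2 * (m : ℝ) ^ 2)) • cosine (2 * m)
        + ((-(Real.pi ^ 2 * ((m + d : ℕ) : ℝ) ^ 2)) • cosine (2 * (m + d))
        + ((2 * Real.pi ^ 2 * m * ((m + d : ℕ) : ℝ)) • cosine d
        + (-(2 * Real.pi ^ 2 * m * ((m + d : ℕ) : ℝ))) • cosine (2 * m + d)))) := by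
    rw [h1]
    ext x
    simp only [Pi.pow_apply, Pi.add_apply, Pi.smul_apply, Pi.one_apply, smul_eq_mul, cosine]
    obtain ⟨M, hM⟩ : ∃ M : ℝ, M = ((m + d : ℕ) : ℝ) := ⟨_, rfl⟩
    have c1 : ((2 * m : ℕ) : ℝ) * Real.pi * x = 2 * (m * Real.pi * x) := by push_cast; ring
    have c2 : ((2 * (m + d) : ℕ) : ℝ) * Real.pi * x = 2 * (M * Real.pi * x) := by
      rw [hM]; push_cast; ring
    have c3 : (d : ℝ) * Real.pi * x = M * Real.pi * x - m * Real.pi * x := by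
      rw [hM]; push_cast; ring
    have c4 : ((2 * m + d : ℕ) : ℝ) * Real.pi * x = M * Real.pi * x + m * Real.pi * x := by
      rw [hM]; push_cast; ring
    rw [c1, c2, c3, c4, ← hM, Real.cos_sub, Real.cos_add, Real.cos_two_mul, Real.cos_two_mul,
      Real.cos_sq', Real.cos_sq']
    ring
  have hcont : ∀ (c : ℝ) (k : ℕ), Continuous (c • cosine k) := fun c k =>
    (contDiff_cosine k).continuous.const_smul c
  rw [h2, cosCoeff_add (by fun_prop) (by fun_prop), cosCoeff_add (by fun_prop) (by fun_prop),
    cosCoeff_add (by fun_prop) (by fun_prop), cosCoeff_add (by fun_prop) (by fun_prop)]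
  simp only [cosCoeff_smul]
  rw [cosCoeff_one, cosCoeff_cosine (by omega), cosCoeff_cosine (by omega),
    cosCoeff_cosine (by omega), cosCoeff_cosine (by omega), if_neg (show ¬ n = 0 by omega)]
  ring

lemma hasSum_mul_ip_cosine_add {m n i : ℕ} (hm : i < m) (hn : i < n) (g : ℕ → ℝ) :
    HasSum (fun j : ℕ+ => g j * ip ((cosine m + cosine n) * phi i) (phi j))
      (g (m + i) - g (m - i) + (g (n + i) - g (n - i))) := by
  refine ((hasSum_mul_ip_cosine hm g).add (hasSum_mul_ip_cosine hn g)).congr_fun fun j => ?_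
  have hc : ∀ k, Continuous (cosine k) := fun k => (contDiff_cosine k).continuous
  rw [ip_mul_phi_phi ((hc m).add (hc n)), ip_mul_phi_phi (hc m), ip_mul_phi_phi (hc n),
    cosCoeff_add (hc m) (hc n), cosCoeff_add (hc m) (hc n)]
  ring

/-- The frequencies `L` and `L' = 2L + K + 1` are in resonance with the product `φ₁φ_K`, which
contains the frequencies `K - 1` and `K + 1`: the relation `2L - L' = -(K + 1)` makes the cubic
coefficient nonzero, and for large `L` it is the only relation of this kind. -/
lemma cubCoeff_cosine_add {K L : ℕ} (hK : 2 ≤ K) (hL : 10 * K ≤ L) :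
    cubCoeff K (cosine L + cosine (L + (L + K + 1)))
      = 4 * Real.pi ^ 4 * (L : ℝ) ^ 2 * (2 * L + K + 1) * (K + 1) := by
  obtain ⟨V, hV⟩ : ∃ V, V = cosine L + cosine (L + (L + K + 1)) := ⟨_, rfl⟩
  have hVd : ContDiff ℝ ∞ V := by rw [hV]; exact (contDiff_cosine _).add (contDiff_cosine _)
  have hVc : Continuous (deriv V ^ 2) := (contDiff_infty_iff_deriv.1 hVd).2.continuous.pow 2
  have D0 : ∀ n, 1 ≤ n → n ≠ 2 * L → n ≠ 2 * (L + (L + K + 1)) → n ≠ L + K + 1 →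
      n ≠ 2 * L + (L + K + 1) → cosCoeff (deriv V ^ 2) n = 0 := by
    intro n h0 h1 h2 h3 h4
    rw [hV, cosCoeff_deriv_sq (by omega) (by omega) h0, if_neg h1, if_neg h2, if_neg h3, if_neg h4]
    ring
  have D1 : ∀ n, n = L + K + 1 → cosCoeff (deriv V ^ 2) n
      = 2 * Real.pi ^ 2 * L * (2 * L + K + 1) := by
    rintro n rfl
    rw [hV, cosCoeff_deriv_sq (by omega) (by omega) (by omega), if_neg (by omega),
      if_neg (by omega), if_pos rfl, if_neg (by omega)]
    push_cast; ring
  have D2 : ∀ n, n = 2 * L → cosCoeff (deriv V ^ 2) n = -(Real.pi ^ 2 * (L : ℝ) ^ 2) := by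
    rintro n rfl
    rw [hV, cosCoeff_deriv_sq (by omega) (by omega) (by omega), if_pos rfl, if_neg (by omega),
      if_neg (by omega), if_neg (by omega)]
    ring
  obtain ⟨w, hw⟩ : ∃ w : ℕ → ℕ → ℝ, w = fun i j => ip (deriv V ^ 2 * phi i) (phi j) := ⟨_, rfl⟩
  have w0 : ∀ i j, w i j = cosCoeff (deriv V ^ 2) ((i : ℤ) - j).natAbs
      - cosCoeff (deriv V ^ 2) (i + j) := fun i j => by rw [hw]; exact ip_mul_phi_phi hVc i j
  have a1 : w K (L + 1) = -(2 * Real.pi ^ 2 * L * (2 * L + K + 1)) := by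
    rw [w0, D0 _ (by omega) (by omega) (by omega) (by omega) (by omega), D1 _ (by omega)]; ring
  have a2 : w K (L - 1) = 0 := by
    rw [w0, D0 _ (by omega) (by omega) (by omega) (by omega) (by omega),
      D0 _ (by omega) (by omega) (by omega) (by omega) (by omega), sub_zero]
  have a3 : w K (L + (L + K + 1) + 1) = 0 := by
    rw [w0, D0 _ (by omega) (by omega) (by omega) (by omega) (by omega),
      D0 _ (by omega) (by omega) (by omega) (by omega) (by omega), sub_zero]
  have a4 : w K (L + (L + K + 1) - 1) = -(Real.pi ^ 2 * (L : ℝ) ^ 2) := by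
    rw [w0, D2 _ (by omega), D0 _ (by omega) (by omega) (by omega) (by omega) (by omega), sub_zero]
  have b1 : w 1 (L + K) = -(2 * Real.pi ^ 2 * L * (2 * L + K + 1)) := by
    rw [w0, D0 _ (by omega) (by omega) (by omega) (by omega) (by omega), D1 _ (by omega)]; ring
  have b2 : w 1 (L - K) = 0 := by
    rw [w0, D0 _ (by omega) (by omega) (by omega) (by omega) (by omega),
      D0 _ (by omega) (by omega) (by omega) (by omega) (by omega), sub_zero]
  have b3 : w 1 (L + (L + K + 1) + K) = 0 := by
    rw [w0, D0 _ (by omega) (by omega) (by omega) (by omega) (by omega),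
      D0 _ (by omega) (by omega) (by omega) (by omega) (by omega), sub_zero]
  have b4 : w 1 (L + (L + K + 1) - K) = -(Real.pi ^ 2 * (L : ℝ) ^ 2) := by
    rw [w0, D2 _ (by omega), D0 _ (by omega) (by omega) (by omega) (by omega) (by omega), sub_zero]
  have s1 : ∑' j : ℕ+, cubTerm₁ K V j = _ := Eq.trans
    (tsum_congr fun j => by
      rw [cubTerm₁, ip_weakDeriv_sq_mul hVd, hV, mul_right_comm, ← hV, hw])
    (hasSum_mul_ip_cosine_add (i := 1) (show 1 < L by omega)
      (show 1 < L + (L + K + 1) by omega) fun j => (lam 1 - lam j) * w K j).tsum_eq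
  have s2 : ∑' j : ℕ+, cubTerm₂ K V j = _ := Eq.trans
    (tsum_congr fun j => by
      rw [cubTerm₂, ip_weakDeriv_sq_mul hVd, ip_mul_comm V, hV, mul_right_comm, ← hV, hw])
    (hasSum_mul_ip_cosine_add (i := K) (show K < L by omega)
      (show K < L + (L + K + 1) by omega) fun j => (lam j - lam K) * w 1 j).tsum_eq
  rw [← hV, cubCoeff, s1, s2]
  simp only [a1, a2, a3, a4, b1, b2, b3, b4]
  rw [show L + (L + K + 1) - 1 = 2 * L + K by omega, show L + (L + K + 1) - K = 2 * L + 1 by omega]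
  simp only [lam]
  push_cast
  ring

/-! ### Moment determinants -/

lemma moment_det_two_pos {p₁ p₂ q₁ q₂ a₁ a₂ b₁ b₂ : ℝ} (hp₁ : 0 < p₁) (hp₂ : 0 < p₂)
    (hq₁ : 0 < q₁) (hq₂ : 0 < q₂) (h₁₁ : a₁ < b₁) (h₁₂ : a₁ < b₂) (h₂₁ : a₂ < b₁) (h₂₂ : a₂ < b₂) :
    0 < (p₁ + p₂) * (q₁ * b₁ + q₂ * b₂) - (p₁ * a₁ + p₂ * a₂) * (q₁ + q₂) := by
  have h : ∀ {p q a b : ℝ}, 0 < p → 0 < q → a < b → 0 < p * q * (b - a) :=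
    fun hp hq hab => mul_pos (mul_pos hp hq) (sub_pos.2 hab)
  linarith [h hp₁ hq₁ h₁₁, h hp₁ hq₂ h₁₂, h hp₂ hq₁ h₂₁, h hp₂ hq₂ h₂₂]

/-- The determinant of the first three moments of three positive measures with two atoms each is
a positive combination of eight Vandermonde determinants with increasing nodes. -/
lemma moment_det_three_pos {p₁ p₂ q₁ q₂ t₁ t₂ a₁ a₂ b₁ b₂ c₁ c₂ : ℝ}
    (hp₁ : 0 < p₁) (hp₂ : 0 < p₂) (hq₁ : 0 < q₁) (hq₂ : 0 < q₂) (ht₁ : 0 < t₁) (ht₂ : 0 < t₂)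
    (ha : a₁ < a₂) (hab : a₂ < b₁) (hb : b₁ < b₂) (hbc : b₂ < c₁) (hc : c₁ < c₂) :
    0 < (p₁ + p₂) * ((q₁ * b₁ + q₂ * b₂) * (t₁ * c₁ ^ 2 + t₂ * c₂ ^ 2)
          - (q₁ * b₁ ^ 2 + q₂ * b₂ ^ 2) * (t₁ * c₁ + t₂ * c₂))
        - (p₁ * a₁ + p₂ * a₂) * ((q₁ + q₂) * (t₁ * c₁ ^ 2 + t₂ * c₂ ^ 2)
          - (q₁ * b₁ ^ 2 + q₂ * b₂ ^ 2) * (t₁ + t₂))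
        + (p₁ * a₁ ^ 2 + p₂ * a₂ ^ 2) * ((q₁ + q₂) * (t₁ * c₁ + t₂ * c₂)
          - (q₁ * b₁ + q₂ * b₂) * (t₁ + t₂)) := by
  have h : ∀ {p q t a b c : ℝ}, 0 < p → 0 < q → 0 < t → a < b → b < c →
      0 < p * q * t * ((b - a) * (c - a) * (c - b)) := fun hp hq ht hab hbc =>
    mul_pos (mul_pos (mul_pos hp hq) ht) (mul_pos (mul_pos (sub_pos.2 hab)
      (sub_pos.2 (hab.trans hbc))) (sub_pos.2 hbc))
  have e₁ := h hp₁ hq₁ ht₁ (ha.trans hab) (hb.trans hbc)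
  have e₂ := h hp₁ hq₁ ht₂ (ha.trans hab) ((hb.trans hbc).trans hc)
  have e₃ := h hp₁ hq₂ ht₁ ((ha.trans hab).trans hb) hbc
  have e₄ := h hp₁ hq₂ ht₂ ((ha.trans hab).trans hb) (hbc.trans hc)
  have e₅ := h hp₂ hq₁ ht₁ hab (hb.trans hbc)
  have e₆ := h hp₂ hq₁ ht₂ hab ((hb.trans hbc).trans hc)
  have e₇ := h hp₂ hq₂ ht₁ (hab.trans hb) hbc
  have e₈ := h hp₂ hq₂ ht₂ (hab.trans hb) (hbc.trans hc)
  linarith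

/-- The mass attached to the frequency `j` in the series `A^p_K`. -/
noncomputable def mass (K j : ℕ) : ℝ := lam j - (lam 1 + lam K) / 2

/-- The node attached to the frequency `j`: up to sign, `A^p_K` is a moment of order `p - 1` with
respect to these nodes. -/
noncomputable def node (K j : ℕ) : ℝ := (lam j - lam K) * (lam j - lam 1)

lemma neg_one_pow_mul_quadWeight (p K j : ℕ) :
    (-1) ^ (p - 1) * quadWeight p K j = mass K j * node K j ^ (p - 1) := by
  rw [quadWeight, mass, node,
    show (lam j - lam K) * (lam j - lam 1) = -1 * (lam K - lam j) * (lam j - lam 1) by ring,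
    mul_pow, mul_pow]
  ring

lemma lam_lt_lam {i j : ℕ} (h : i < j) : lam i < lam j := by
  have : (i : ℝ) < j := by exact_mod_cast h
  have hpi := Real.pi_pos
  unfold lam
  gcongr

lemma mass_pos {K j : ℕ} (hK : 2 ≤ K) (hj : K < j) : 0 < mass K j := by
  have h1 := lam_lt_lam hj
  have h2 := lam_lt_lam (show 1 < K by omega)
  unfold mass; linarith

lemma node_lt_node {K i j : ℕ} (hK : 2 ≤ K) (hi : K < i) (hij : i < j) :
    node K i < node K j := by
  have h1 := lam_lt_lam hi
  have h2 := lam_lt_lam (show 1 < K by omega)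
  have h3 := lam_lt_lam hij
  unfold node
  exact mul_lt_mul'' (by linarith) (by linarith) (by linarith) (by linarith)

/-- The interaction, in `A^p_K`, of the cosines with the frequencies `n` and `n + K + 1`. It
takes place through the eigenfunctions with the indices `n + 1` and `n + K`. -/
noncomputable def moment (p K n : ℕ) : ℝ :=
  mass K (n + 1) * node K (n + 1) ^ (p - 1) + mass K (n + K) * node K (n + K) ^ (p - 1)

lemma moment_minor_pos {K m n : ℕ} (hK : 2 ≤ K) (hm : K ≤ m) (hmn : m + K < n) :
    0 < moment 1 K m * moment 2 K n - moment 2 K m * moment 1 K n := by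
  have := moment_det_two_pos (mass_pos hK (show K < m + 1 by omega))
    (mass_pos hK (show K < m + K by omega)) (mass_pos hK (show K < n + 1 by omega))
    (mass_pos hK (show K < n + K by omega))
    (node_lt_node hK (show K < m + 1 by omega) (show m + 1 < n + 1 by omega))
    (node_lt_node hK (show K < m + 1 by omega) (show m + 1 < n + K by omega))
    (node_lt_node hK (show K < m + K by omega) (show m + K < n + 1 by omega))
    (node_lt_node hK (show K < m + K by omega) (show m + K < n + K by omega))
  simpa [moment] using this

lemma moment_det_pos {K l m n : ℕ} (hK : 2 ≤ K) (hl : K ≤ l) (hlm : l + K < m + 1)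
    (hmn : m + K < n + 1) :
    0 < moment 1 K l * (moment 2 K m * moment 3 K n - moment 3 K m * moment 2 K n)
      - moment 2 K l * (moment 1 K m * moment 3 K n - moment 3 K m * moment 1 K n)
      + moment 3 K l * (moment 1 K m * moment 2 K n - moment 2 K m * moment 1 K n) := by
  have := moment_det_three_pos (mass_pos hK (show K < l + 1 by omega))
    (mass_pos hK (show K < l + K by omega)) (mass_pos hK (show K < m + 1 by omega))
    (mass_pos hK (show K < m + K by omega)) (mass_pos hK (show K < n + 1 by omega))
    (mass_pos hK (show K < n + K by omega))
    (node_lt_node hK (show K < l + 1 by omega) (show l + 1 < l + K by omega))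
    (node_lt_node hK (show K < l + K by omega) (show l + K < m + 1 by omega))
    (node_lt_node hK (show K < m + 1 by omega) (show m + 1 < m + K by omega))
    (node_lt_node hK (show K < m + K by omega) (show m + K < n + 1 by omega))
    (node_lt_node hK (show K < n + 1 by omega) (show n + 1 < n + K by omega))
  simpa [moment] using this

/-! ### The family of candidates -/

/-- The five frequencies used: `L = 20K` and `L' = 2L + K + 1`, which resonate in the cubic
coefficient, and `L + (K + 1)`, `L' + (K + 1)`, `L - (K + 1)`, each of which interacts with one of
`L` and `L'` in the quadratic coefficients. -/
def freq (K : ℕ) : Fin 5 → ℕ := ![20 * K, 41 * K + 1, 21 * K + 1, 42 * K + 2, 19 * K - 1]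

/-- The function `ε f + ∑ yᵢ · 2 cos(nᵢπx)`, where the `nᵢ` are the frequencies `freq K`. -/
noncomputable def candidate (K : ℕ) (f : ℝ → ℝ) (ε : ℝ) (y : Fin 5 → ℝ) : ℝ → ℝ :=
  ε • f + ∑ i, y i • cosine (freq K i)

lemma freq_bound {K : ℕ} (hK : 2 ≤ K) (i : Fin 5) : K + 2 < freq K i := by
  fin_cases i <;> simp [freq] <;> omega

lemma freq_separated {K : ℕ} (hK : 2 ≤ K) {i k : Fin 5} (h : i ≠ k) :
    freq K i ≠ freq K k ∧ freq K i ≠ freq K k + 2 := by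
  fin_cases i <;> fin_cases k <;> simp [freq] at h ⊢ <;> omega

lemma candidate_eq_sum (K : ℕ) (f : ℝ → ℝ) (ε : ℝ) (y : Fin 5 → ℝ) :
    candidate K f ε y = ∑ i : Fin 6, (Fin.cons ε y : Fin 6 → ℝ) i •
      (Fin.cons f (fun i => cosine (freq K i)) : Fin 6 → ℝ → ℝ) i := by
  rw [Fin.sum_univ_succ]
  simp [candidate]

lemma family_mem {K : ℕ} (hK : 2 ≤ K) {f : ℝ → ℝ} (hf : f ∈ admissible) (i : Fin 6) :
    (Fin.cons f (fun i => cosine (freq K i)) : Fin 6 → ℝ → ℝ) i ∈ admissible := by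
  refine Fin.cases ?_ (fun i => ?_) i
  · simpa using hf
  · simpa using cosine_mem_admissible (show 1 ≤ freq K i by have := freq_bound hK i; omega)

lemma candidate_mem {K : ℕ} (hK : 2 ≤ K) {f : ℝ → ℝ} (hf : f ∈ admissible) (ε : ℝ)
    (y : Fin 5 → ℝ) : candidate K f ε y ∈ admissible := by
  rw [candidate_eq_sum]
  exact Submodule.sum_mem _ fun i _ => Submodule.smul_mem _ _ (family_mem hK hf i)

lemma continuous_cubCoeff_candidate {K : ℕ} (hK : 2 ≤ K) {f : ℝ → ℝ} (hf : f ∈ admissible) :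
    Continuous fun q : ℝ × (Fin 5 → ℝ) => cubCoeff K (candidate K f q.1 q.2) := by
  simp only [candidate_eq_sum]
  refine (continuous_cubCoeff_sum K (family_mem hK hf)).comp (continuous_pi fun i => ?_)
  refine Fin.cases ?_ (fun i => ?_) i
  · simpa using continuous_fst
  · simp only [Fin.cons_succ]; fun_prop

/-- For `ε = 0` only the three pairs of frequencies at distance `K + 1` contribute to `A^p_K`; all
other differences of frequencies are different from `K - 1` and `K + 1`. -/
lemma quadCoeff_candidate {K p : ℕ} (hK : 2 ≤ K) (hp : p ≤ 3) {f : ℝ → ℝ} (hf : f ∈ admissible) :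
    ∃ (E : ℝ) (G : Fin 5 → ℝ), ∀ (ε : ℝ) (y : Fin 5 → ℝ),
      quadCoeff p K (candidate K f ε y)
        = ε * (ε * E + ∑ i, y i * G i) - (y 0 * y 2 * moment p K (20 * K)
          + y 1 * y 3 * moment p K (41 * K + 1) + y 0 * y 4 * moment p K (19 * K - 1)) := by
  refine ⟨(-1) ^ (p - 1) * quadForm p K f f, fun i => (-1) ^ (p - 1) *
    (quadForm p K f (cosine (freq K i)) + quadForm p K (cosine (freq K i)) f), fun ε y => ?_⟩
  have pair₁ : ∀ m n, K < m → n = m + K + 1 →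
      quadForm p K (cosine m) (cosine n) = -quadWeight p K (m + 1) := by
    intro m n hm hn
    rw [quadForm_cosine p (by omega) (by omega), if_neg (by omega), if_pos (by omega),
      if_neg (by omega), if_neg (by omega)]
    ring
  have pair₂ : ∀ m n, K < m → n = m + K + 1 →
      quadForm p K (cosine n) (cosine m) = -quadWeight p K (m + K) := by
    intro m n hm hn
    rw [quadForm_cosine p (by omega) (by omega), if_neg (by omega), if_neg (by omega),
      if_pos (by omega), if_neg (by omega), show n - 1 = m + K by omega]
    ring
  have z : ∀ m n, (2 ≤ m ∧ K < n ∧ m + 1 ≠ n + K ∧ m + 1 + K ≠ n ∧ m - 1 ≠ n + K ∧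
      m - 1 + K ≠ n) → quadForm p K (cosine m) (cosine n) = 0 := by
    rintro m n ⟨h1, h2, h3, h4, h5, h6⟩
    rw [quadForm_cosine p h1 h2, if_neg h3, if_neg h4, if_neg h5, if_neg h6]
    ring
  have hm : ∀ n, moment p K n
      = (-1) ^ (p - 1) * (quadWeight p K (n + 1) + quadWeight p K (n + K)) := fun n => by
    rw [mul_add, neg_one_pow_mul_quadWeight, neg_one_pow_mul_quadWeight, moment]
  have main : ∑ i, ∑ k, y i * y k * quadForm p K (cosine (freq K i)) (cosine (freq K k))
      = -(y 0 * y 2 * (quadWeight p K (20 * K + 1) + quadWeight p K (20 * K + K))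
        + y 1 * y 3 * (quadWeight p K (41 * K + 1 + 1) + quadWeight p K (41 * K + 1 + K))
        + y 0 * y 4 * (quadWeight p K (19 * K - 1 + 1) + quadWeight p K (19 * K - 1 + K))) := by
    have e : freq K 0 = 20 * K ∧ freq K 1 = 41 * K + 1 ∧ freq K 2 = 21 * K + 1 ∧
        freq K 3 = 42 * K + 2 ∧ freq K 4 = 19 * K - 1 := ⟨rfl, rfl, rfl, rfl, rfl⟩
    simp only [Fin.sum_univ_five, e]
    rw [pair₁ (20 * K) (21 * K + 1) (by omega) (by omega),
      pair₂ (20 * K) (21 * K + 1) (by omega) (by omega),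
      pair₁ (41 * K + 1) (42 * K + 2) (by omega) (by omega),
      pair₂ (41 * K + 1) (42 * K + 2) (by omega) (by omega),
      pair₁ (19 * K - 1) (20 * K) (by omega) (by omega),
      pair₂ (19 * K - 1) (20 * K) (by omega) (by omega),
      z (20 * K) (20 * K) (by omega), z (20 * K) (41 * K + 1) (by omega),
      z (20 * K) (42 * K + 2) (by omega), z (41 * K + 1) (20 * K) (by omega),
      z (41 * K + 1) (41 * K + 1) (by omega), z (41 * K + 1) (21 * K + 1) (by omega),
      z (41 * K + 1) (19 * K - 1) (by omega), z (21 * K + 1) (41 * K + 1) (by omega),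
      z (21 * K + 1) (21 * K + 1) (by omega), z (21 * K + 1) (42 * K + 2) (by omega),
      z (21 * K + 1) (19 * K - 1) (by omega), z (42 * K + 2) (20 * K) (by omega),
      z (42 * K + 2) (21 * K + 1) (by omega), z (42 * K + 2) (42 * K + 2) (by omega),
      z (42 * K + 2) (19 * K - 1) (by omega), z (19 * K - 1) (41 * K + 1) (by omega),
      z (19 * K - 1) (21 * K + 1) (by omega), z (19 * K - 1) (42 * K + 2) (by omega),
      z (19 * K - 1) (19 * K - 1) (by omega)]
    ring
  rw [candidate_eq_sum, quadCoeff_sum hp K _ (family_mem hK hf)]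
  simp only [Fin.sum_univ_succ (n := 5), Fin.cons_zero, Fin.cons_succ]
  rw [Finset.sum_add_distrib, main, hm, hm, hm]
  simp only [Fin.sum_univ_five]
  ring

lemma ip_candidate_mul {K : ℕ} (hK : 2 ≤ K) {f : ℝ → ℝ} (hf : f ∈ admissible) (ε : ℝ)
    (y : Fin 5 → ℝ) {j : ℕ} (hj : 1 ≤ j) :
    ip (candidate K f ε y * phi 1) (phi j) = ε * ip (f * phi 1) (phi j)
      + ∑ i, y i * ((if j = freq K i + 1 then 1 else 0) - if j + 1 = freq K i then 1 else 0) := by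
  rw [candidate_eq_sum, ip_sum_mul _ fun i => (family_mem hK hf i).1.continuous,
    Fin.sum_univ_succ]
  simp only [Fin.cons_zero, Fin.cons_succ]
  congr 1
  refine Finset.sum_congr rfl fun i _ => ?_
  rw [ip_cosine_mul (by have := freq_bound hK i; omega) hj]

/-- If the coefficients at the ten neighbors of the frequencies do not vanish, then `HLin` is
inherited from the background `f`. -/
lemma hLin_candidate {K : ℕ} (hK : 2 ≤ K) {f : ℝ → ℝ} (hf : f ∈ admissible)
    (hfK : ip (f * phi 1) (phi K) = 0)
    (hfj : ∀ j : ℕ, 1 ≤ j → j ≠ K → 1 / (j : ℝ) ^ 7 ≤ |ip (f * phi 1) (phi j)|)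
    {ε : ℝ} (hε : 0 < ε) {y : Fin 5 → ℝ}
    (hup : ∀ i, ε * ip (f * phi 1) (phi (freq K i + 1)) + y i ≠ 0)
    (hdown : ∀ i, ε * ip (f * phi 1) (phi (freq K i - 1)) - y i ≠ 0) :
    HLin K (candidate K f ε y) := by
  have far : ∀ j, (∀ i, j ≠ freq K i + 1 ∧ j + 1 ≠ freq K i) → 1 ≤ j →
      ip (candidate K f ε y * phi 1) (phi j) = ε * ip (f * phi 1) (phi j) := by
    intro j h hj
    rw [ip_candidate_mul hK hf ε y hj, add_eq_left]
    exact Finset.sum_eq_zero fun i _ => by rw [if_neg (h i).1, if_neg (h i).2]; ring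
  have up : ∀ i, ip (candidate K f ε y * phi 1) (phi (freq K i + 1))
      = ε * ip (f * phi 1) (phi (freq K i + 1)) + y i := by
    intro i
    have hi := freq_bound hK i
    rw [ip_candidate_mul hK hf ε y (by omega), Finset.sum_eq_single i, if_pos rfl,
      if_neg (by omega)]
    · ring
    · intro k _ hk
      have h1 := freq_separated hK hk
      rw [if_neg (by omega), if_neg (by omega)]; ring
    · simp
  have down : ∀ i, ip (candidate K f ε y * phi 1) (phi (freq K i - 1))
      = ε * ip (f * phi 1) (phi (freq K i - 1)) - y i := by
    intro i
    have hi := freq_bound hK i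
    rw [ip_candidate_mul hK hf ε y (by omega), Finset.sum_eq_single i, if_neg (by omega),
      if_pos (by omega)]
    · ring
    · intro k _ hk
      have h1 := freq_separated hK hk.symm
      have h2 := freq_separated hK hk
      rw [if_neg (by omega), if_neg (by omega)]; ring
    · simp
  refine ⟨?_, ?_⟩
  · rw [far K (fun i => by have := freq_bound hK i; omega) (by omega), hfK, mul_zero]
  obtain ⟨i₀, hi₀⟩ := Finite.exists_min fun i =>
    min |ε * ip (f * phi 1) (phi (freq K i + 1)) + y i|
      |ε * ip (f * phi 1) (phi (freq K i - 1)) - y i|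
  obtain ⟨c, hc⟩ : ∃ c, c = min |ε * ip (f * phi 1) (phi (freq K i₀ + 1)) + y i₀|
      |ε * ip (f * phi 1) (phi (freq K i₀ - 1)) - y i₀| := ⟨_, rfl⟩
  rw [← hc] at hi₀
  have hc0 : 0 < c := by
    rw [hc]; exact lt_min (abs_pos.2 (hup i₀)) (abs_pos.2 (hdown i₀))
  refine ⟨min ε c, lt_min hε hc0, fun j hj hjK => ?_⟩
  have hj' : (1 : ℝ) ≤ (j : ℝ) ^ 7 := one_le_pow₀ (by exact_mod_cast hj)
  have hle : min ε c / (j : ℝ) ^ 7 ≤ c :=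
    (div_le_self (lt_min hε hc0).le hj').trans (min_le_right _ _)
  by_cases h : ∀ i, j ≠ freq K i + 1 ∧ j + 1 ≠ freq K i
  · rw [far j h hj, abs_mul, abs_of_pos hε]
    calc min ε c / (j : ℝ) ^ 7 ≤ ε / (j : ℝ) ^ 7 := by gcongr; exact min_le_left _ _
      _ = ε * (1 / (j : ℝ) ^ 7) := by ring
      _ ≤ _ := by gcongr; exact hfj j hj hjK
  · simp only [not_forall, not_and_or, not_not] at h
    obtain ⟨i, rfl | h⟩ := h
    · rw [up]
      exact hle.trans ((hi₀ i).trans (min_le_left _ _))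
    · obtain rfl : j = freq K i - 1 := by omega
      rw [down]
      exact hle.trans ((hi₀ i).trans (min_le_right _ _))

/-! ### Solving the quadratic equations -/

open Filter Topology

/-- Cramer's rule, with continuous dependence on a parameter. -/
lemma exists_continuousAt_solution {a₁ b₁ c₁ a₂ b₂ c₂ : ℝ → ℝ} (ha₁ : Continuous a₁)
    (hb₁ : Continuous b₁) (hc₁ : Continuous c₁) (ha₂ : Continuous a₂) (hb₂ : Continuous b₂)
    (hc₂ : Continuous c₂) (hdet : a₁ 0 * b₂ 0 - a₂ 0 * b₁ 0 ≠ 0) :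
    ∃ u v : ℝ → ℝ, ContinuousAt u 0 ∧ ContinuousAt v 0 ∧ ∀ᶠ ε in 𝓝 (0 : ℝ),
      a₁ ε * u ε + b₁ ε * v ε + c₁ ε = 0 ∧ a₂ ε * u ε + b₂ ε * v ε + c₂ ε = 0 := by
  have hd : Continuous fun ε => a₁ ε * b₂ ε - a₂ ε * b₁ ε := by fun_prop
  refine ⟨fun ε => (b₁ ε * c₂ ε - b₂ ε * c₁ ε) / (a₁ ε * b₂ ε - a₂ ε * b₁ ε),
    fun ε => (a₂ ε * c₁ ε - a₁ ε * c₂ ε) / (a₁ ε * b₂ ε - a₂ ε * b₁ ε),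
    ContinuousAt.div (by fun_prop) hd.continuousAt hdet,
    ContinuousAt.div (by fun_prop) hd.continuousAt hdet, ?_⟩
  filter_upwards [hd.continuousAt.eventually_ne hdet] with ε hε
  constructor
  all_goals
    rw [mul_div_assoc', mul_div_assoc', ← add_div, div_add' _ _ _ hε, div_eq_zero_iff]
    left; ring

end DipoleMoment

open DipoleMoment Filter Topology in
theorem theoremA1 (K : ℕ) (hK : 2 ≤ K) :
    ∃ μ : ℝ → ℝ, DipoleMoment.HReg μ ∧ DipoleMoment.HLin K μ ∧
      DipoleMoment.HQuad K μ ∧ DipoleMoment.HCub K μ := by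
  obtain ⟨f, hf, hfK, hfj⟩ := exists_linear_background hK
  obtain ⟨E₁, G₁, q₁⟩ := quadCoeff_candidate hK (show 1 ≤ 3 by omega) hf
  obtain ⟨E₂, G₂, q₂⟩ := quadCoeff_candidate hK (show 2 ≤ 3 by omega) hf
  obtain ⟨E₃, G₃, q₃⟩ := quadCoeff_candidate hK (show 3 ≤ 3 by omega) hf
  have minor₁₂ := moment_minor_pos hK (show K ≤ 20 * K by omega)
    (show 20 * K + K < 41 * K + 1 by omega)
  have minor₀₂ := moment_minor_pos hK (show K ≤ 19 * K - 1 by omega)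
    (show 19 * K - 1 + K < 41 * K + 1 by omega)
  have minor₀₁ := moment_minor_pos hK (show K ≤ 19 * K - 1 by omega)
    (show 19 * K - 1 + K < 20 * K by omega)
  have det₃ := moment_det_pos hK (show K ≤ 19 * K - 1 by omega)
    (show 19 * K - 1 + K < 20 * K + 1 by omega) (show 20 * K + K < 41 * K + 1 + 1 by omega)
  have hC := continuous_cubCoeff_candidate hK hf
  obtain ⟨P, hP⟩ : ∃ P : ℕ → ℝ, P = fun p => moment p K (19 * K - 1) := ⟨_, rfl⟩
  obtain ⟨Q, hQ⟩ : ∃ Q : ℕ → ℝ, Q = fun p => moment p K (20 * K) := ⟨_, rfl⟩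
  obtain ⟨R, hR⟩ : ∃ R : ℕ → ℝ, R = fun p => moment p K (41 * K + 1) := ⟨_, rfl⟩
  have hP' : ∀ p, moment p K (19 * K - 1) = P p := fun p => by rw [hP]
  have hQ' : ∀ p, moment p K (20 * K) = Q p := fun p => by rw [hQ]
  have hR' : ∀ p, moment p K (41 * K + 1) = R p := fun p => by rw [hR]
  simp only [hP', hQ', hR'] at q₁ q₂ q₃ minor₁₂ minor₀₂ minor₀₁ det₃
  -- for `ε = 0` and the fifth amplitude `δ`, the third and fourth amplitudes which make `A¹`
  -- and `A²` vanish are `δ * ζ` and `δ * ξ`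
  obtain ⟨ζ, hζ⟩ : ∃ ζ, ζ = (R 1 * P 2 - R 2 * P 1) / (Q 1 * R 2 - Q 2 * R 1) := ⟨_, rfl⟩
  obtain ⟨ξ, hξ⟩ : ∃ ξ, ξ = (Q 2 * P 1 - Q 1 * P 2) / (Q 1 * R 2 - Q 2 * R 1) := ⟨_, rfl⟩
  have hζ0 : ζ ≠ 0 := by rw [hζ]; exact div_ne_zero (by linarith) minor₁₂.ne'
  have hξ0 : ξ ≠ 0 := by rw [hξ]; exact div_ne_zero (by linarith) minor₁₂.ne'
  -- a small `δ` preserves `C ≠ 0`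
  obtain ⟨δ, hδ0, hδ⟩ : ∃ δ : ℝ, 0 < δ ∧
      cubCoeff K (candidate K f 0 ![1, 1, δ * ζ, δ * ξ, δ]) ≠ 0 := by
    have hcont : ContinuousAt
        (fun δ : ℝ => cubCoeff K (candidate K f 0 ![1, 1, δ * ζ, δ * ξ, δ])) 0 := by
      refine (hC.comp (f := fun δ : ℝ => ((0 : ℝ), ![1, 1, δ * ζ, δ * ξ, δ])) ?_).continuousAt
      refine continuous_const.prodMk (continuous_pi fun i => ?_)
      fin_cases i <;> simp <;> fun_prop
    have h0 : cubCoeff K (candidate K f 0 ![1, 1, 0 * ζ, 0 * ξ, 0]) ≠ 0 := by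
      have e : candidate K f 0 ![1, 1, 0 * ζ, 0 * ξ, 0]
          = cosine (20 * K) + cosine (20 * K + (20 * K + K + 1)) := by
        rw [show 20 * K + (20 * K + K + 1) = 41 * K + 1 by omega]
        simp [candidate, Fin.sum_univ_five, freq]
      rw [e, cubCoeff_cosine_add hK (by omega)]
      have : (0 : ℝ) < K := by exact_mod_cast (by omega : 0 < K)
      have hpi := Real.pi_pos
      positivity
    have h1 := (hcont.eventually_ne h0).filter_mono (nhdsWithin_le_nhds (s := Ioi 0))
    obtain ⟨δ, h2, h3⟩ := (h1.and self_mem_nhdsWithin).exists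
    exact ⟨δ, h3, h2⟩
  obtain ⟨u, v, hu, hv, huv⟩ := exists_continuousAt_solution
    (a₁ := fun ε => ε * G₁ 2 - Q 1) (b₁ := fun ε => ε * G₁ 3 - R 1)
    (c₁ := fun ε => ε * (ε * E₁ + G₁ 0 + G₁ 1 + δ * G₁ 4) - δ * P 1)
    (a₂ := fun ε => ε * G₂ 2 - Q 2) (b₂ := fun ε => ε * G₂ 3 - R 2)
    (c₂ := fun ε => ε * (ε * E₂ + G₂ 0 + G₂ 1 + δ * G₂ 4) - δ * P 2)
    (by fun_prop) (by fun_prop) (by fun_prop) (by fun_prop) (by fun_prop) (by fun_prop)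
    (by simp only [zero_mul, zero_sub]; linarith)
  have huv0 := huv.self_of_nhds
  simp only [zero_mul, zero_sub] at huv0
  have hu0 : u 0 = δ * ζ := by
    rw [hζ, ← mul_div_assoc, eq_div_iff minor₁₂.ne']
    linear_combination (-R 2) * huv0.1 + R 1 * huv0.2
  have hv0 : v 0 = δ * ξ := by
    rw [hξ, ← mul_div_assoc, eq_div_iff minor₁₂.ne']
    linear_combination Q 2 * huv0.1 - Q 1 * huv0.2
  obtain ⟨y, hy⟩ : ∃ y : ℝ → Fin 5 → ℝ, y = fun ε => ![1, 1, u ε, v ε, δ] := ⟨_, rfl⟩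
  have hyc : ContinuousAt y 0 := by
    rw [hy]
    refine continuousAt_pi.2 fun i => ?_
    fin_cases i <;> simp <;> first | exact continuousAt_const | assumption
  have hy0 : ∀ i, y 0 i ≠ 0 := by
    intro i
    rw [hy]
    fin_cases i <;> simp [hu0, hv0, hδ0.ne', hζ0, hξ0]
  have hyi : ∀ i, ContinuousAt (fun ε => y ε i) 0 := fun i => continuousAt_pi.1 hyc i
  have ev_cub : ∀ᶠ ε in 𝓝 (0 : ℝ), cubCoeff K (candidate K f ε (y ε)) ≠ 0 := by
    have : ContinuousAt (fun ε => cubCoeff K (candidate K f ε (y ε))) 0 :=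
      ContinuousAt.comp (f := fun ε => (ε, y ε)) hC.continuousAt (continuousAt_id.prodMk hyc)
    refine this.eventually_ne ?_
    rw [hy]
    simpa only [hu0, hv0] using hδ
  have ev_quad : ∀ᶠ ε in 𝓝 (0 : ℝ), quadCoeff 3 K (candidate K f ε (y ε)) ≠ 0 := by
    simp only [q₃, Fin.sum_univ_five]
    refine ContinuousAt.eventually_ne (by fun_prop) ?_
    simp only [hy, Matrix.cons_val, hu0, hv0]
    intro h
    have h1 : δ * (ζ * Q 3 + ξ * R 3 + P 3) = 0 := by linear_combination -h
    have h2 := (mul_eq_zero.1 h1).resolve_left hδ0.ne'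
    have eζ : ζ * (Q 1 * R 2 - Q 2 * R 1) = R 1 * P 2 - R 2 * P 1 := by
      rw [hζ, div_mul_cancel₀ _ minor₁₂.ne']
    have eξ : ξ * (Q 1 * R 2 - Q 2 * R 1) = Q 2 * P 1 - Q 1 * P 2 := by
      rw [hξ, div_mul_cancel₀ _ minor₁₂.ne']
    exact det₃.ne' (by
      linear_combination (Q 1 * R 2 - Q 2 * R 1) * h2 - Q 3 * eζ - R 3 * eξ)
  have ev_up : ∀ᶠ ε in 𝓝 (0 : ℝ), ∀ i,
      ε * ip (f * phi 1) (phi (freq K i + 1)) + y ε i ≠ 0 := by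
    refine eventually_all.2 fun i => ContinuousAt.eventually_ne ?_ (by simpa using hy0 i)
    have := hyi i
    fun_prop
  have ev_down : ∀ᶠ ε in 𝓝 (0 : ℝ), ∀ i,
      ε * ip (f * phi 1) (phi (freq K i - 1)) - y ε i ≠ 0 := by
    refine eventually_all.2 fun i => ContinuousAt.eventually_ne ?_ (by simpa using hy0 i)
    have := hyi i
    fun_prop
  have ev := (huv.and (ev_cub.and (ev_quad.and (ev_up.and ev_down)))).filter_mono
    (nhdsWithin_le_nhds (s := Ioi 0))
  obtain ⟨ε, ⟨huv, h_cub, h_quad, h_up, h_down⟩, hε⟩ := (ev.and self_mem_nhdsWithin).exists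
  have hmem := candidate_mem hK hf ε (y ε)
  refine ⟨candidate K f ε (y ε), hReg_of_mem hmem, hLin_candidate hK hf hfK hfj hε h_up h_down,
    ⟨summable_quadTerm (by omega) K hmem, summable_quadTerm (by omega) K hmem,
      summable_quadTerm (by omega) K hmem, ?_, ?_, h_quad⟩,
    (summable_cubTerm K hmem).1, (summable_cubTerm K hmem).2, h_cub⟩
  · simp only [q₁, Fin.sum_univ_five, hy, Matrix.cons_val]
    linear_combination huv.1
  · simp only [q₂, Fin.sum_univ_five, hy, Matrix.cons_val]
    linear_combination huv.2
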